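/- Let $A=(a_1,\dots,a_n)$ be a configuration of $n$ points in $\mathbb R^d$ in general position: every subconfiguration of at most $D+1$ of the points is affinely independent, where $D$ is the dimension of the affine span of $A$ (so $D=d$ if $A$ spans $\mathbb R^d$). Let $k\in[n-1]=\{1,\dots,n-1\}$. Let $\Delta_n^{(k)}=\operatorname{conv}\{e_B : B\in\binom{[n]}{k}\}\subset\mathbb R^n$, $e_B=\sum_{i\in B}e_i$, be the hypersimplex, let $\pi:\mathbb R^n\to\mathbb R^d$ be the linear map with $\pi(e_i)=a_i$, and let $A^{(k)}$ be the point configuration, labelled by $\binom{[n]}{k}$, of the points $\pi(e_B)=\sum_{i\in B}a_i$. A polyhedral subdivision of a labelled configuration is a collection of nonempty sets of labels (cells) that is closed under taking nonempty faces (the face of a cell selected by a linear functional is the set of all labels in the cell at whose points the functional is minimal over the cell), whose convex hulls cover the convex hull of the configuration, and in which different cells have disjoint relative interiors. A hypersimplicial subdivision of $A^{(k)}$ is a polyhedral subdivision of $A^{(k)}$ in which every cell is the set of (labels of) vertices of a face $F$ of $\Delta_n^{(k)}$; it is a hypertriangulation if moreover $\dim F=\dim\pi(F)$ for all these faces $F$.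 A tile is an interval $[X,Y]=\{I: X\subseteq I\subseteq Y\}$ with $X\subseteq Y\subseteq[n]$. A hypersimplicial subdivision contains the tile $[X,Y]$ if $\{B\in\binom{[n]}{k}: X\subseteq B\subseteq Y\}$ is one of its cells and either $|X|<k<|Y|$, or $X=Y$ and $|X|=k$; every cell comes from exactly one such tile. A circuit of $A$ is a pair $(C^+,C^-)$ consisting of the set of indices of the positive coefficients and that of the negative coefficients of a nonzero affine dependence of $A$ with inclusion-minimal support. Two tiles $[X_1,Y_1]$, $[X_2,Y_2]$ are separated if there is no circuit $(C^+,C^-)$ of $A$ with $C^+\subseteq Y_1\setminus X_2$, $C^-\subseteq Y_2\setminus X_1$ and $C^+\cup C^-\not\subseteq (Y_1\cap Y_2)\setminus(X_1\cup X_2)$. If no hypertriangulation of $A^{(k)}$ contains two non-separated tiles, then no hypersimplicial subdivision of $A^{(k)}$ contains two non-separated tiles. -/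

import Mathlib

namespace Hypersimplicial

/-! ### Polyhedral subdivisions of labelled point configurations -/

section Subdivisions

variable {ι V E : Type*}
  [AddCommGroup V] [Module ℝ V]
  [NormedAddCommGroup E] [NormedSpace ℝ E]

/-- For a labelled point configuration `p : ι → V` and a set of labels `C`, the set of labels `F` is
a (nonempty) face of the subconfiguration `C`: it consists of all the labels in `C` at which some
linear functional attains its minimum over `C`. The zero functional gives the face `C` itself. -/
def IsFace (p : ι → V) (F C : Set ι) : Prop :=
  F.Nonempty ∧ ∃ f : V →ₗ[ℝ] ℝ, F = {i | i ∈ C ∧ ∀ j ∈ C, f (p i) ≤ f (p j)}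

/-- A polyhedral subdivision of the labelled point configuration `p : ι → E`: a collection of
(nonempty) sets of labels, the cells (of all dimensions), that is closed under taking faces, whose
convex hulls cover the convex hull of the configuration, and such that different cells have
disjoint relative interiors. -/
structure IsPolyhedralSubdivision (p : ι → E) (S : Set (Set ι)) : Prop where
  nonempty : ∀ C ∈ S, C.Nonempty
  face_mem : ∀ C ∈ S, ∀ F, IsFace p F C → F ∈ S
  union_eq : (⋃ C ∈ S, convexHull ℝ (p '' C)) = convexHull ℝ (Set.range p)
  disjoint_relint : ∀ C ∈ S, ∀ D ∈ S, C ≠ D →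
    Disjoint (intrinsicInterior ℝ (convexHull ℝ (p '' C)))
      (intrinsicInterior ℝ (convexHull ℝ (p '' D)))

/-- Let `q : ι → V` list the vertices of a polytope `Q`, and let `π` be a linear map. A `π`-induced
subdivision is a polyhedral subdivision of the configuration `π ∘ q` each of whose cells is the
image of (the set of vertices of) a face of `Q`. -/
def IsInducedSubdivision (q : ι → V) (π : V →ₗ[ℝ] E) (S : Set (Set ι)) : Prop :=
  IsPolyhedralSubdivision (fun i => π (q i)) S ∧ ∀ C ∈ S, IsFace q C Set.univ

/-- A `π`-induced subdivision is fine if `dim F = dim π(F)` for each face `F` of `Q` whose image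
is a cell. -/
def IsFineInducedSubdivision (q : ι → V) (π : V →ₗ[ℝ] E) (S : Set (Set ι)) : Prop :=
  IsInducedSubdivision q π S ∧ ∀ C ∈ S,
    Module.finrank ℝ (vectorSpan ℝ (q '' C)) =
      Module.finrank ℝ (vectorSpan ℝ ((fun i => π (q i)) '' C))

end Subdivisions

/-! ### Hypersimplicial subdivisions -/

variable {n d : ℕ}

/-- The labels of the vertices of the `k`-th hypersimplex: the `k`-subsets of `[n]`. -/
abbrev KSubset (n k : ℕ) : Type := {B : Finset (Fin n) // B.card = k}

/-- The vertex `∑ i ∈ B, e i` of the `k`-th hypersimplex. -/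
def hypersimplexVertex (n k : ℕ) (B : KSubset n k) : Fin n → ℝ :=
  ∑ i ∈ B.1, Pi.single i 1

/-- The linear map that sends `e i` to `a i`. It sends the vertex of the `k`-th hypersimplex with
label `B` to the point `∑ i ∈ B, a i` of the deleted Minkowski sum `A^(k)`. -/
def proj (a : Fin n → EuclideanSpace ℝ (Fin d)) :
    (Fin n → ℝ) →ₗ[ℝ] EuclideanSpace ℝ (Fin d) :=
  Fintype.linearCombination ℝ a

/-- Hypersimplicial subdivisions of `A^(k)`. -/
def IsHypersimplicialSubdivision (a : Fin n → EuclideanSpace ℝ (Fin d)) (k : ℕ)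
    (S : Set (Set (KSubset n k))) : Prop :=
  IsInducedSubdivision (hypersimplexVertex n k) (proj a) S

/-- Hypertriangulations of `A^(k)`: the fine hypersimplicial subdivisions. -/
def IsHypertriangulation (a : Fin n → EuclideanSpace ℝ (Fin d)) (k : ℕ)
    (S : Set (Set (KSubset n k))) : Prop :=
  IsFineInducedSubdivision (hypersimplexVertex n k) (proj a) S

/-! ### Tiles and separation -/

/-- `[X, Y]^(k)`: the `k`-subsets in the interval `[X, Y]`. -/
def levelSlice (k : ℕ) (X Y : Finset (Fin n)) : Set (KSubset n k) :=
  {B | X ⊆ B.1 ∧ B.1 ⊆ Y}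

/-- The collection of cells `S` contains the tile `[X, Y]`: the cell `[X, Y]^(k)` belongs to `S`,
where either `[X, Y]` covers level `k`, or the cell is a point `B`, for which the tile
is `[B, B]`. (So each cell comes from exactly one tile.) -/
def ContainsTile {k : ℕ} (S : Set (Set (KSubset n k))) (X Y : Finset (Fin n)) : Prop :=
  X ⊆ Y ∧ ((X.card < k ∧ k < Y.card) ∨ (X = Y ∧ X.card = k)) ∧ levelSlice k X Y ∈ S

/-- Coefficient vectors of affine dependences of `a`. -/
def IsAffineDependence (a : Fin n → EuclideanSpace ℝ (Fin d)) (c : Fin n → ℝ) : Prop :=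
  ∑ i, c i = 0 ∧ ∑ i, c i • a i = 0

/-- `(Cp, Cm)` is an oriented circuit of `a`: the sets of indices of the positive and of the negative
coefficients in a nonzero affine dependence of inclusion-minimal support. -/
def IsCircuit (a : Fin n → EuclideanSpace ℝ (Fin d)) (Cp Cm : Finset (Fin n)) : Prop :=
  ∃ c : Fin n → ℝ, IsAffineDependence a c ∧ c ≠ 0 ∧
    (∀ c' : Fin n → ℝ, IsAffineDependence a c' → c' ≠ 0 →
      Function.support c' ⊆ Function.support c → Function.support c' = Function.support c) ∧
    (∀ i, i ∈ Cp ↔ 0 < c i) ∧ (∀ i, i ∈ Cm ↔ c i < 0)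

/-- The tiles `[X₁, Y₁]` and `[X₂, Y₂]` are separated (with respect to `a`). -/
def Separated (a : Fin n → EuclideanSpace ℝ (Fin d)) (X₁ Y₁ X₂ Y₂ : Finset (Fin n)) : Prop :=
  ¬ ∃ Cp Cm : Finset (Fin n), IsCircuit a Cp Cm ∧
    Cp ⊆ Y₁ \ X₂ ∧ Cm ⊆ Y₂ \ X₁ ∧ ¬ (Cp ∪ Cm ⊆ (Y₁ ∩ Y₂) \ (X₁ ∪ X₂))

/-- The collection of cells `S` contains two non-separated tiles. -/
def ContainsNonSeparatedTiles (a : Fin n → EuclideanSpace ℝ (Fin d)) {k : ℕ}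
    (S : Set (Set (KSubset n k))) : Prop :=
  ∃ X₁ Y₁ X₂ Y₂ : Finset (Fin n), ContainsTile S X₁ Y₁ ∧ ContainsTile S X₂ Y₂ ∧
    ¬ Separated a X₁ Y₁ X₂ Y₂

/-- The configuration `a` is in general position (its oriented matroid is uniform): every
subconfiguration of at most `D + 1` elements is affinely independent, where `D` is the dimension of
the affine span of `a` (so `D = d` if `a` affinely spans `ℝ^d`). -/
def InGeneralPosition (a : Fin n → EuclideanSpace ℝ (Fin d)) : Prop :=
  ∀ s : Finset (Fin n), s.card ≤ Module.finrank ℝ (vectorSpan ℝ (Set.range a)) + 1 →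
    AffineIndependent ℝ (fun i : s => a i)

end Hypersimplicial

/-! The proof is by contraposition: a hypersimplicial subdivision with two non-separated tiles is
refined to a hypertriangulation that still has two.

Lift each cell `C` by heights `∑ i ∈ B, w C i` with its own weights `w C`, and replace it by its
lower faces. The pieces fit together if the heights of a cell and of each proper face differ by an
affine function on that face (`IsPolyhedralSubdivision.lowerFaces`). In general position this is
automatic: a functional constant on `D + 1` of the points is constant on all of them, so a proper
face of the image of a tile is a tile `[X', Y']` with `Y' \ X'` affinely independent, and on such a
tile every height is affine. Hence the weights can be chosen cell by cell. On a lower face the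
weights are affine on the free elements; generic weights force these to be affinely independent, so
the refinement is fine (`isHypertriangulation_lowerFaces`).

It remains to preserve a circuit `(Cp, Cm)` witnessing non-separation. The two tiles are distinct,
so their weights are independent. For the first tile, weights are found with a lower face `[X', Y']`
such that `Cp ⊆ Y'` and `Cm` misses `X'`; for the second, the roles of `Cp` and `Cm` are exchanged
(`exists_isGeneric_subtile`). These two conditions are what the circuit needs, and its failure to
lie in `(Y₁ ∩ Y₂) \ (X₁ ∪ X₂)` survives shrinking the intervals. The construction needs `D > 0`; for
`D = 0` a subdivision has only one cell. -/

namespace Hypersimplicial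

open Set

set_option linter.unusedSectionVars false

/-! ### Minimizers over a finite set of labels -/

section Argmin

variable {ι : Type*}

/-- The labels in `C` at which `u` attains its minimum over `C`. -/
def argminOn (u : ι → ℝ) (C : Set ι) : Set ι := {i | i ∈ C ∧ ∀ j ∈ C, u i ≤ u j}

theorem argminOn_subset (u : ι → ℝ) (C : Set ι) : argminOn u C ⊆ C := fun _ h => h.1

theorem argminOn_nonempty [Finite ι] (u : ι → ℝ) {C : Set ι} (hC : C.Nonempty) :
    (argminOn u C).Nonempty := by
  obtain ⟨i, hi, h⟩ := Set.exists_min_image C u C.toFinite hC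
  exact ⟨i, hi, h⟩

theorem argminOn_eq_of_add_const {u v : ι → ℝ} {C : Set ι} {c : ℝ}
    (h : ∀ i ∈ C, u i = v i + c) : argminOn u C = argminOn v C := by
  ext i
  constructor
  · rintro ⟨hi, hj⟩
    refine ⟨hi, fun j hjC => ?_⟩
    have := hj j hjC
    rw [h i hi, h j hjC] at this
    linarith
  · rintro ⟨hi, hj⟩
    refine ⟨hi, fun j hjC => ?_⟩
    rw [h i hi, h j hjC]
    linarith [hj j hjC]

theorem argminOn_restrict {u : ι → ℝ} {C D : Set ι} (hD : D ⊆ C) (hne : (argminOn u C).Nonempty)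
    (h : argminOn u C ⊆ D) : argminOn u C = argminOn u D := by
  obtain ⟨k, hk⟩ := hne
  ext i
  constructor
  · intro hi
    exact ⟨h hi, fun j hj => hi.2 j (hD hj)⟩
  · rintro ⟨hi, hj⟩
    exact ⟨hD hi, fun j hjC => (hj k (h hk)).trans (hk.2 j hjC)⟩

/-- Lexicographic minimization is minimization of a small perturbation: there are finitely many
strict inequalities between values of `u`, and a small `ε` preserves all of them. This makes a face
of a face a face. -/
theorem exists_pos_argminOn_argminOn [Finite ι] (u v : ι → ℝ) (C : Set ι) :
    ∃ ε : ℝ, 0 < ε ∧ argminOn v (argminOn u C) = argminOn (fun i => u i + ε * v i) C := by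
  have key : ∀ᶠ ε in nhdsWithin (0 : ℝ) (Ioi 0), ∀ i j : ι, u i < u j →
      u i + ε * v i < u j + ε * v j := by
    rw [Filter.eventually_all]
    intro i
    rw [Filter.eventually_all]
    intro j
    by_cases h : u i < u j
    · have h1 : Filter.Tendsto (fun ε : ℝ => u j + ε * v j - (u i + ε * v i)) (nhds 0)
          (nhds (u j + 0 * v j - (u i + 0 * v i))) := by
        apply Continuous.tendsto (f := fun ε : ℝ => u j + ε * v j - (u i + ε * v i))
        fun_prop
      have h2 := (h1.eventually (lt_mem_nhds (by simpa using h :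
        (0 : ℝ) < u j + 0 * v j - (u i + 0 * v i)))).filter_mono
          (nhdsWithin_le_nhds (s := Ioi 0))
      filter_upwards [h2] with ε hε _
      linarith
    · exact Filter.Eventually.of_forall fun ε h' => absurd h' h
  obtain ⟨ε, hε, hpos⟩ := (key.and self_mem_nhdsWithin).exists
  have hpos : 0 < ε := hpos
  refine ⟨ε, hpos, ?_⟩
  ext i
  constructor
  · rintro ⟨⟨hiC, hi⟩, hv⟩
    refine ⟨hiC, fun j hj => ?_⟩
    rcases (hi j hj).lt_or_eq with h | h
    · exact (hε i j h).le
    · have : v i ≤ v j := hv j ⟨hj, fun l hl => h ▸ hi l hl⟩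
      have := mul_le_mul_of_nonneg_left this hpos.le
      linarith
  · rintro ⟨hiC, hi⟩
    have hmin : ∀ j ∈ C, u i ≤ u j := fun j hj => by
      by_contra! h
      exact absurd (hi j hj) (not_le.2 (hε j i h))
    refine ⟨⟨hiC, hmin⟩, fun j hj => ?_⟩
    have h1 : u i = u j := le_antisymm (hmin j hj.1) (hj.2 i hiC)
    have h2 := hi j hj.1
    have h3 : ε * v i ≤ ε * v j := by linarith
    exact le_of_mul_le_mul_left h3 hpos

end Argmin

/-! ### Relative interiors of convex hulls of finite configurations -/

section Core

variable {ι E : Type*} [Finite ι] [NormedAddCommGroup E] [InnerProductSpace ℝ E]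
  [FiniteDimensional ℝ E]

open scoped InnerProductSpace

/-- `x` lies in the convex hull of `p '' C`, and every linear functional which is minimal at `x`
over `p '' C` is constant there. This says that `x` is in the relative interior of the convex
hull. -/
def InCore (p : ι → E) (C : Set ι) (x : E) : Prop :=
  x ∈ convexHull ℝ (p '' C) ∧
    ∀ f : E →ₗ[ℝ] ℝ, (∀ i ∈ C, f x ≤ f (p i)) → ∀ i ∈ C, f (p i) = f x

theorem sub_mem_vectorSpan_of_mem_convexHull {p : ι → E} {C : Set ι} {x y : E}
    (hx : x ∈ convexHull ℝ (p '' C)) (hy : y ∈ affineSpan ℝ (p '' C)) :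
    y - x ∈ vectorSpan ℝ (p '' C) := by
  rw [← direction_affineSpan]
  exact AffineSubspace.vsub_mem_direction hy (convexHull_subset_affineSpan _ hx)

theorem exists_inner_lt_of_notMem_convexHull {p : ι → E} {C : Set ι} {x z : E} {W : Submodule ℝ E}
    (hW : ∀ i ∈ C, p i - x ∈ W) (hz : z ∈ W) (h : x + z ∉ convexHull ℝ (p '' C)) :
    ∃ y ∈ W, ∀ i ∈ C, ⟪y, z⟫_ℝ < ⟪y, p i - x⟫_ℝ := by
  obtain ⟨f, u, hfu, hf⟩ := geometric_hahn_banach_point_closed (convex_convexHull ℝ (p '' C))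
    ((C.toFinite.image p).isClosed_convexHull ℝ) h
  set y := (InnerProductSpace.toDual ℝ E).symm f with hy
  have hyf : ∀ v, ⟪y, v⟫_ℝ = f v := fun v => by simp [hy]
  -- Projecting the separating vector onto `W` does not change its pairing with vectors of `W`.
  have hproj : ∀ v ∈ W, ⟪((W.orthogonalProjectionOnto y : W) : E), v⟫_ℝ = ⟪y, v⟫_ℝ := fun v hv => by
    exact Submodule.inner_orthogonalProjectionOnto_eq_of_mem_right (K := W) ⟨v, hv⟩ y
  refine ⟨W.orthogonalProjectionOnto y, Subtype.coe_prop _, fun i hi => ?_⟩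
  rw [hproj _ hz, hproj _ (hW i hi), hyf, hyf]
  have h1 := hf (p i) (subset_convexHull ℝ _ ⟨i, hi, rfl⟩)
  rw [map_add] at hfu
  rw [map_sub]
  linarith

/-- The minimum over `C` of `⟪v, p i - x⟫` is continuous in `v` and negative for nonzero `v` in the
direction space, so compactness of the unit sphere gives a uniform bound, extended by homogeneity.
-/
theorem InCore.exists_pos_inner_le {p : ι → E} {C : Set ι} {x : E} (h : InCore p C x) :
    ∃ δ : ℝ, 0 < δ ∧ ∀ v ∈ vectorSpan ℝ (p '' C), ∃ i ∈ C, ⟪v, p i - x⟫_ℝ ≤ -(δ * ‖v‖) := by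
  have hne : C.Nonempty := by
    have : (p '' C).Nonempty := convexHull_nonempty_iff.1 ⟨x, h.1⟩
    simpa using this
  set F := C.toFinite.toFinset with hF
  have hFne : F.Nonempty := by simpa [hF] using hne
  set W := vectorSpan ℝ (p '' C) with hW
  set m : W → ℝ := fun v => F.inf' hFne (fun i => ⟪(v : E), p i - x⟫_ℝ) with hm
  have hmc : Continuous m := by
    apply Continuous.finset_inf'_apply
    intro i _
    fun_prop
  have hneg : ∀ v : W, v ≠ 0 → m v < 0 := by
    intro v hv
    by_contra! hcon
    rw [hm, Finset.le_inf'_iff] at hcon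
    have h1 : ∀ i ∈ C, ⟪(v : E), p i⟫_ℝ = ⟪(v : E), x⟫_ℝ := by
      refine h.2 (innerₛₗ ℝ (v : E)) fun i hi => ?_
      have := hcon i (by simpa [hF] using hi)
      rw [inner_sub_right] at this
      simp only [innerₛₗ_apply_apply]
      linarith
    have h2 : W ≤ LinearMap.ker (innerₛₗ ℝ (v : E)) := by
      refine Submodule.span_le.2 ?_
      rintro _ ⟨_, ⟨i, hi, rfl⟩, _, ⟨j, hj, rfl⟩, rfl⟩
      simp [inner_sub_right, h1 i hi, h1 j hj]
    have h3 := h2 v.2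
    rw [LinearMap.mem_ker, innerₛₗ_apply_apply, inner_self_eq_zero] at h3
    exact hv (by simpa using h3)
  have hatt : ∀ v : W, ∃ i ∈ C, ⟪(v : E), p i - x⟫_ℝ ≤ m v := by
    intro v
    obtain ⟨i, hi, hi'⟩ := Finset.exists_mem_eq_inf' hFne (fun i => ⟪(v : E), p i - x⟫_ℝ)
    exact ⟨i, by simpa [hF] using hi, hi'.ge⟩
  -- The sphere is empty exactly when the direction space is zero; then any `δ` works.
  rcases (Metric.sphere (0 : W) 1).eq_empty_or_nonempty with hs | hs
  · refine ⟨1, one_pos, fun v hv => ?_⟩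
    have hv0 : v = 0 := by
      by_contra hv0
      have : (‖(⟨v, hv⟩ : W)‖⁻¹ • (⟨v, hv⟩ : W)) ∈ Metric.sphere (0 : W) 1 := by
        rw [mem_sphere_zero_iff_norm, norm_smul, norm_inv, norm_norm, inv_mul_cancel₀]
        simpa using hv0
      rw [hs] at this
      exact this
    obtain ⟨i, hi⟩ := hne
    exact ⟨i, hi, by simp [hv0]⟩
  · obtain ⟨v₀, hv₀, hmax⟩ := (isCompact_sphere (0 : W) 1).exists_isMaxOn hs hmc.continuousOn
    have hv₀0 : v₀ ≠ 0 := by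
      rintro rfl
      simp at hv₀
    refine ⟨-m v₀, by linarith [hneg v₀ hv₀0], fun v hv => ?_⟩
    by_cases hv0 : v = 0
    · obtain ⟨i, hi⟩ := hne
      exact ⟨i, hi, by simp [hv0]⟩
    · have hnorm : 0 < ‖v‖ := norm_pos_iff.2 hv0
      have hu : (‖v‖⁻¹ • (⟨v, hv⟩ : W)) ∈ Metric.sphere (0 : W) 1 := by
        rw [mem_sphere_zero_iff_norm, norm_smul, norm_inv, norm_norm]
        exact inv_mul_cancel₀ hnorm.ne'
      obtain ⟨i, hi, hi'⟩ := hatt (‖v‖⁻¹ • (⟨v, hv⟩ : W))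
      refine ⟨i, hi, ?_⟩
      have h4 := hi'.trans (hmax hu)
      simp only [Submodule.coe_smul, real_inner_smul_left] at h4
      rw [inv_mul_le_iff₀ hnorm] at h4
      linarith

/-- The ball of radius `δ` about `x` in the affine span stays in the hull: a functional separating
one of its points from the hull would contradict the uniform bound. -/
theorem InCore.mem_intrinsicInterior {p : ι → E} {C : Set ι} {x : E} (h : InCore p C x) :
    x ∈ intrinsicInterior ℝ (convexHull ℝ (p '' C)) := by
  obtain ⟨δ, hδ, hv⟩ := h.exists_pos_inner_le
  refine _root_.mem_intrinsicInterior.2 ⟨⟨x, subset_affineSpan ℝ _ h.1⟩, ?_, rfl⟩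
  rw [mem_interior_iff_mem_nhds, Metric.mem_nhds_iff]
  refine ⟨δ, hδ, ?_⟩
  rintro ⟨z, hz⟩ hzx
  rw [Metric.mem_ball, Subtype.dist_eq, dist_eq_norm] at hzx
  rw [affineSpan_convexHull] at hz
  by_contra hcon
  have hcon : x + (z - x) ∉ convexHull ℝ (p '' C) := by simpa using hcon
  obtain ⟨y, hy, hlt⟩ := exists_inner_lt_of_notMem_convexHull
    (W := vectorSpan ℝ (p '' C))
    (fun i hi => sub_mem_vectorSpan_of_mem_convexHull h.1
      (subset_affineSpan ℝ _ ⟨i, hi, rfl⟩))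
    (sub_mem_vectorSpan_of_mem_convexHull h.1 hz) hcon
  obtain ⟨i, hi, hle⟩ := hv y hy
  have h1 := hlt i hi
  have h2 : -(‖y‖ * ‖z - x‖) ≤ ⟪y, z - x⟫_ℝ := neg_le_of_abs_le (abs_real_inner_le_norm y (z - x))
  have h3 : ‖y‖ * ‖z - x‖ ≤ ‖y‖ * δ := mul_le_mul_of_nonneg_left hzx.le (norm_nonneg y)
  linarith

theorem inCore_of_mem_intrinsicInterior {p : ι → E} {C : Set ι} {x : E}
    (h : x ∈ intrinsicInterior ℝ (convexHull ℝ (p '' C))) : InCore p C x := by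
  refine ⟨intrinsicInterior_subset h, fun f hf i hi => ?_⟩
  have hconv : ∀ z ∈ convexHull ℝ (p '' C), f x ≤ f z := by
    intro z hz
    have : convexHull ℝ (p '' C) ⊆ {z | f x ≤ f z} := by
      apply convexHull_min
      · rintro _ ⟨j, hj, rfl⟩
        exact hf j hj
      · exact convex_halfSpace_ge f.isLinear _
    exact this hz
  refine le_antisymm ?_ (hf i hi)
  obtain ⟨⟨x', hx'⟩, hint, rfl⟩ := mem_intrinsicInterior.1 h
  have hpi : p i ∈ affineSpan ℝ (convexHull ℝ (p '' C)) :=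
    subset_affineSpan ℝ _ (subset_convexHull ℝ _ ⟨i, hi, rfl⟩)
  have hline : ∀ t : ℝ, AffineMap.lineMap x' (p i) t ∈ affineSpan ℝ (convexHull ℝ (p '' C)) :=
    fun t => AffineMap.lineMap_mem t hx' hpi
  have hcont : Continuous fun t : ℝ =>
      (⟨AffineMap.lineMap x' (p i) t, hline t⟩ : affineSpan ℝ (convexHull ℝ (p '' C))) := by
    exact Continuous.subtype_mk AffineMap.lineMap_continuous _
  have h0 : (⟨AffineMap.lineMap x' (p i) (0 : ℝ), hline 0⟩ :
      affineSpan ℝ (convexHull ℝ (p '' C))) = ⟨x', hx'⟩ := by simp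
  have hev := hcont.tendsto 0
  rw [h0] at hev
  -- The segment from `p i` to `x'` can be prolonged slightly beyond `x'` inside the hull; there `f`
  -- would drop below its minimum if `f (p i) > f x'`.
  have hev := (hev.eventually (mem_interior_iff_mem_nhds.1 hint)).filter_mono
    (nhdsWithin_le_nhds (s := Iio 0))
  obtain ⟨t, ht, hneg⟩ := (hev.and self_mem_nhdsWithin).exists
  have hneg : t < 0 := hneg
  have h1 := hconv _ ht
  simp only [AffineMap.lineMap_apply, vsub_eq_sub, vadd_eq_add, map_add, map_smul, map_sub,
    smul_eq_mul] at h1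
  nlinarith

/-- A point of the convex hull at which `f` is minimal lies in the convex hull of the face
selected by `f`. -/
theorem mem_convexHull_argminOn {p : ι → E} {C : Set ι} {x : E} (hx : x ∈ convexHull ℝ (p '' C))
    {f : E →ₗ[ℝ] ℝ} (hf : ∀ i ∈ C, f x ≤ f (p i)) :
    x ∈ convexHull ℝ (p '' argminOn (fun i => f (p i)) C) ∧
      ∀ i ∈ C, (i ∈ argminOn (fun i => f (p i)) C ↔ f (p i) = f x) := by
  have hmem : x ∈ convexHull ℝ (p '' {i ∈ C | f (p i) = f x}) := by
    have hx' := hx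
    rw [_root_.convexHull_eq] at hx'
    obtain ⟨κ, t, w, z, hw0, hw1, hz, hxt⟩ := hx'
    have hge : ∀ i ∈ t, f x ≤ f (z i) := by
      intro i hi
      obtain ⟨j, hj, hji⟩ := hz i hi
      exact hji ▸ hf j hj
    have hsum : ∑ i ∈ t, w i * (f (z i) - f x) = 0 := by
      have h1 : f x = ∑ i ∈ t, w i * f (z i) := by
        rw [← hxt, Finset.centerMass_eq_of_sum_1 _ _ hw1]
        simp
      simp only [mul_sub, Finset.sum_sub_distrib, ← Finset.sum_mul, hw1]
      linarith
    rw [Finset.sum_eq_zero_iff_of_nonneg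
      (fun i hi => mul_nonneg (hw0 i hi) (by linarith [hge i hi]))] at hsum
    rw [← Finset.centerMass_filter_ne_zero] at hxt
    have key : Finset.centerMass {i ∈ t | w i ≠ 0} w z ∈
        convexHull ℝ (p '' {i ∈ C | f (p i) = f x}) := by
      apply Finset.centerMass_mem_convexHull
      · exact fun i hi => hw0 i (Finset.mem_filter.1 hi).1
      · rw [Finset.sum_filter_ne_zero, hw1]
        exact one_pos
      · intro i hi
        obtain ⟨hi, hwi⟩ := Finset.mem_filter.1 hi
        obtain ⟨j, hj, hji⟩ := hz i hi
        have h2 := (mul_eq_zero.1 (hsum i hi)).resolve_left hwi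
        refine ⟨j, ⟨hj, ?_⟩, hji⟩
        rw [hji]
        exact sub_eq_zero.1 h2
    rwa [hxt] at key
  have hiff : ∀ i ∈ C, (i ∈ argminOn (fun i => f (p i)) C ↔ f (p i) = f x) := by
    have hne : (p '' {i ∈ C | f (p i) = f x}).Nonempty := convexHull_nonempty_iff.1 ⟨x, hmem⟩
    obtain ⟨_, k, ⟨hk, hkx⟩, rfl⟩ := hne
    exact fun i hi => ⟨fun h => le_antisymm ((h.2 k hk).trans hkx.le) (hf i hi),
      fun h => ⟨hi, fun j hj => h.le.trans (hf j hj)⟩⟩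
  refine ⟨convexHull_mono (image_mono ?_) hmem, hiff⟩
  rintro i ⟨hi, hix⟩
  exact (hiff i hi).2 hix

/-- Every point of the convex hull lies in the relative interior of a face. -/
theorem exists_face_inCore {p : ι → E} (C : Set ι) {x : E} (hx : x ∈ convexHull ℝ (p '' C)) :
    ∃ F, IsFace p F C ∧ InCore p F x := by
  by_cases h : InCore p C x
  · have hne : (p '' C).Nonempty := convexHull_nonempty_iff.1 ⟨x, hx⟩
    exact ⟨C, ⟨by simpa using hne, 0, by simp⟩, h⟩
  · simp only [InCore, hx, true_and] at h
    push Not at h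
    obtain ⟨f, hf, i, hi, hix⟩ := h
    obtain ⟨hxF, hiff⟩ := mem_convexHull_argminOn hx hf
    have hlt : argminOn (fun i => f (p i)) C ⊂ C :=
      ⟨argminOn_subset _ _, fun hsub => hix ((hiff i hi).1 (hsub hi))⟩
    have hcard : (argminOn (fun i => f (p i)) C).ncard < C.ncard :=
      Set.ncard_lt_ncard hlt C.toFinite
    obtain ⟨G, ⟨hGne, g, hG⟩, hGx⟩ := exists_face_inCore _ hxF
    obtain ⟨ε, -, hε⟩ := exists_pos_argminOn_argminOn (fun i => f (p i)) (fun i => g (p i)) C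
    refine ⟨G, ⟨hGne, f + ε • g, ?_⟩, hGx⟩
    have hG' : G = argminOn (fun i => g (p i)) (argminOn (fun i => f (p i)) C) := hG
    rw [hG', hε]
    simp [argminOn]
termination_by C.ncard

/-- The lower faces of a configuration lifted by the heights `w` cover its convex hull, at points
of the relative interior. -/
theorem InCore.exists_mem_convexHull_lowerFace {p : ι → E} {C : Set ι} {x : E}
    (h : InCore p C x) (w : ι → ℝ) :
    ∃ f : E →ₗ[ℝ] ℝ, x ∈ convexHull ℝ (p '' argminOn (fun i => w i + f (p i)) C) := by
  have hne : C.Nonempty := by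
    have : (p '' C).Nonempty := convexHull_nonempty_iff.1 ⟨x, h.1⟩
    simpa using this
  set F := C.toFinite.toFinset with hF
  have hmF : ∀ i, i ∈ F ↔ i ∈ C := by simp [hF]
  have hFne : F.Nonempty := by simpa [hF] using hne
  let W := vectorSpan ℝ (p '' C)
  -- For each slope `v`, this is the largest height over `x` of an affine function with that slope
  -- (up to sign) lying below the lifted points. A maximizer gives the supporting function of the
  -- lower hull over `x`.
  let m : W → ℝ := fun v => F.inf' hFne (fun i => w i + ⟪(v : E), p i - x⟫_ℝ)
  have hmc : Continuous m := by
    apply Continuous.finset_inf'_apply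
    intro i _
    fun_prop
  obtain ⟨δ, hδ, hle⟩ := h.exists_pos_inner_le
  have hlim : Filter.Tendsto m (Filter.cocompact W) Filter.atBot := by
    have h1 : Filter.Tendsto (fun v : W => F.sup' hFne w + -(δ * ‖v‖)) (Filter.cocompact W)
        Filter.atBot := by
      apply Filter.tendsto_atBot_add_const_left
      apply Filter.tendsto_neg_atTop_atBot.comp
      exact (tendsto_norm_cocompact_atTop (E := W)).const_mul_atTop hδ
    refine Filter.tendsto_atBot_mono (fun v => ?_) h1
    obtain ⟨i, hi, hi'⟩ := hle v v.2
    have hi := (hmF i).2 hi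
    calc m v ≤ w i + ⟪(v : E), p i - x⟫_ℝ :=
          Finset.inf'_le (fun i => w i + ⟪(v : E), p i - x⟫_ℝ) hi
      _ ≤ _ := add_le_add (Finset.le_sup' w hi) hi'
  obtain ⟨v, hv⟩ := hmc.exists_forall_ge hlim
  set u : ι → ℝ := fun i => w i + ⟪(v : E), p i - x⟫_ℝ with hu
  have hWmem : ∀ i ∈ C, p i - x ∈ W := fun i hi =>
    sub_mem_vectorSpan_of_mem_convexHull h.1 (subset_affineSpan ℝ _ ⟨i, hi, rfl⟩)
  have hx : x ∈ convexHull ℝ (p '' argminOn u C) := by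
    -- If `x` is outside the hull of the active labels, a separating direction `y` increases all
    -- active terms; for small `ε` the minimum is still attained at an active label, so moving along
    -- `y` increases `m`.
    by_contra hcon
    obtain ⟨y, hy, hlt⟩ := exists_inner_lt_of_notMem_convexHull (p := p) (z := 0)
      (fun i (hi : i ∈ argminOn u C) => hWmem i hi.1) W.zero_mem (by simpa using hcon)
    obtain ⟨ε, hε, heq⟩ := exists_pos_argminOn_argminOn u (fun i => ⟪y, p i - x⟫_ℝ) C
    have hmax := hv (v + ε • (⟨y, hy⟩ : W))
    obtain ⟨i, hi⟩ := argminOn_nonempty (fun i => u i + ε * ⟪y, p i - x⟫_ℝ) hne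
    have hiu : i ∈ argminOn u C := by
      rw [← heq] at hi
      exact hi.1
    have h1 : u i + ε * ⟪y, p i - x⟫_ℝ ≤ m (v + ε • (⟨y, hy⟩ : W)) := by
      refine (Finset.le_inf'_iff hFne _).2 fun j hj => ?_
      have := hi.2 j ((hmF j).1 hj)
      simpa [hu, inner_add_left, real_inner_smul_left, add_assoc] using this
    have h2 : m v ≤ u i :=
      Finset.inf'_le (fun i => w i + ⟪(v : E), p i - x⟫_ℝ) ((hmF i).2 hiu.1)
    have h3 := hlt i hiu
    rw [inner_zero_right] at h3
    have h4 := mul_pos hε h3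
    have h5 : u i ≤ m v := by
      refine (Finset.le_inf'_iff hFne _).2 fun j hj => ?_
      exact hiu.2 j ((hmF j).1 hj)
    have h6 : m (v + ε • (⟨y, hy⟩ : W)) ≤ m v := hmax
    linarith
  refine ⟨innerₛₗ ℝ (v : E), ?_⟩
  rwa [argminOn_eq_of_add_const (v := u) (c := ⟪(v : E), x⟫_ℝ)]
  intro i _
  simp only [hu, inner_sub_right, innerₛₗ_apply_apply]
  ring

/-! ### Refining the cells of a subdivision -/

/-- The collection of the lower faces of the cells of `S`, each cell `C` being lifted by its own
height function `w C`. -/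
def lowerFaces (p : ι → E) (S : Set (Set ι)) (w : Set ι → ι → ℝ) : Set (Set ι) :=
  {F | ∃ C ∈ S, ∃ f : E →ₗ[ℝ] ℝ, F = argminOn (fun i => w C i + f (p i)) C}

theorem IsPolyhedralSubdivision.eq_of_inCore {p : ι → E} {S : Set (Set ι)}
    (hS : IsPolyhedralSubdivision p S) {C D : Set ι} (hC : C ∈ S) (hD : D ∈ S) {x : E}
    (hxC : InCore p C x) (hxD : InCore p D x) : C = D := by
  by_contra hne
  exact Set.disjoint_left.1 (hS.disjoint_relint C hC D hD hne) hxC.mem_intrinsicInterior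
    hxD.mem_intrinsicInterior

/-- Compare the two supporting affine functions below the lifted points. The one of `f` touches on a
set whose hull contains `x`, so at `x` it is at least the one of `g`. On the face of `g` the
inequality is reversed. Since `x` is in the core of that face, the difference is constant, hence
zero, there, so both functions touch at its labels. -/
theorem argminOn_subset_of_inCore {p : ι → E} {C : Set ι} {x : E} {w : ι → ℝ} {f g : E →ₗ[ℝ] ℝ}
    (hf : x ∈ convexHull ℝ (p '' argminOn (fun i => w i + f (p i)) C))
    (hg : InCore p (argminOn (fun i => w i + g (p i)) C) x) :
    argminOn (fun i => w i + g (p i)) C ⊆ argminOn (fun i => w i + f (p i)) C := by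
  set F := argminOn (fun i => w i + f (p i)) C with hF
  set G := argminOn (fun i => w i + g (p i)) C with hG
  have hmin : ∀ i ∈ F, ∀ j ∈ C, w i + f (p i) ≤ w j + f (p j) := fun i hi => hi.2
  have hFne : (p '' F).Nonempty := convexHull_nonempty_iff.1 ⟨x, hf⟩
  have hGne : (p '' G).Nonempty := convexHull_nonempty_iff.1 ⟨x, hg.1⟩
  obtain ⟨_, i₀, hi₀, rfl⟩ := hFne
  obtain ⟨_, j₀, hj₀, rfl⟩ := hGne
  have hle : w j₀ + g (p j₀) - g x ≤ w i₀ + f (p i₀) - f x := by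
    have : convexHull ℝ (p '' F) ⊆
        {y | w j₀ + g (p j₀) - (w i₀ + f (p i₀)) ≤ (g - f) y} := by
      apply convexHull_min
      · rintro _ ⟨i, hi, rfl⟩
        have h1 := hj₀.2 i hi.1
        have h2 := hi.2 i₀ hi₀.1
        simp only [mem_ofPred_eq, LinearMap.sub_apply]
        linarith
      · exact convex_halfSpace_ge (g - f).isLinear _
    have h3 := this hf
    simp only [mem_ofPred_eq, LinearMap.sub_apply] at h3
    linarith
  have hconst : ∀ j ∈ G, (f - g) (p j) = (f - g) x := by
    have hge : ∀ j ∈ G, w i₀ + f (p i₀) - (w j₀ + g (p j₀)) ≤ (f - g) (p j) := by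
      intro j hj
      have h1 := hi₀.2 j hj.1
      have h2 := hj.2 j₀ hj₀.1
      simp only [LinearMap.sub_apply]
      linarith
    refine hg.2 (f - g) fun j hj => ?_
    have := hge j hj
    simp only [LinearMap.sub_apply] at this ⊢
    linarith
  intro j hj
  refine ⟨hj.1, fun l hl => ?_⟩
  have h1 := hconst j hj
  have h2 := hj.2 j₀ hj₀.1
  have h3 := hi₀.2 l hl
  simp only [LinearMap.sub_apply] at h1
  linarith

/-- If every cell of a polyhedral subdivision is lifted in such a way that the heights on a cell
and on each of its proper faces differ by an affine function, then the lower faces of the lifted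
cells form a polyhedral subdivision. -/
theorem IsPolyhedralSubdivision.lowerFaces {p : ι → E} {S : Set (Set ι)}
    (hS : IsPolyhedralSubdivision p S) (w : Set ι → ι → ℝ)
    (hw : ∀ C ∈ S, ∀ F, IsFace p F C → F ≠ C →
      ∃ (f : E →ₗ[ℝ] ℝ) (c : ℝ), ∀ i ∈ F, w C i = w F i + f (p i) + c) :
    IsPolyhedralSubdivision p (lowerFaces p S w) := by
  have hne : ∀ C ∈ Hypersimplicial.lowerFaces p S w, C.Nonempty := by
    rintro _ ⟨C, hC, f, rfl⟩
    exact argminOn_nonempty _ (hS.nonempty C hC)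
  -- A lower face of a cell with core point `x` is also a lower face of the face `F` carrying `x` in
  -- its core. By disjointness in `S`, this `F` depends only on `x`, so overlapping lower faces can
  -- be compared under one lifting.
  have hcore : ∀ C ∈ Hypersimplicial.lowerFaces p S w, ∀ x, InCore p C x → ∃ F ∈ S, InCore p F x ∧
      ∃ f : E →ₗ[ℝ] ℝ, C = argminOn (fun i => w F i + f (p i)) F := by
    rintro _ ⟨C, hC, f, rfl⟩ x hx
    obtain ⟨F, hFC, hFx⟩ := exists_face_inCore C
      (convexHull_mono (image_mono (argminOn_subset _ _)) hx.1)
    refine ⟨F, hS.face_mem C hC F hFC, hFx, ?_⟩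
    by_cases hFC' : F = C
    · subst hFC'
      exact ⟨f, rfl⟩
    obtain ⟨g, c, hg⟩ := hw C hC F hFC hFC'
    obtain ⟨-, φ, hφ⟩ := hFC
    have hφ : F = argminOn (fun i => φ (p i)) C := hφ
    have hle : ∀ i ∈ C, φ x ≤ φ (p i) := by
      have : convexHull ℝ (p '' F) ⊆ {y | ∀ i ∈ C, φ y ≤ φ (p i)} := by
        have hset : {y | ∀ i ∈ C, φ y ≤ φ (p i)} = ⋂ i ∈ C, {y | φ y ≤ φ (p i)} := by
          ext; simp
        apply convexHull_min
        · rintro _ ⟨i, hi, rfl⟩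
          rw [hφ] at hi
          exact hi.2
        · rw [hset]
          exact convex_iInter₂ fun i _ => convex_halfSpace_le φ.isLinear _
      exact this hFx.1
    -- The functional `φ` cutting out `F` is minimal at `x`, hence constant on the lower face, which
    -- therefore lies in `F`.
    have hsub : argminOn (fun i => w C i + f (p i)) C ⊆ F := by
      intro i hi
      have h1 := hx.2 φ (fun j hj => hle j hj.1) i hi
      rw [hφ]
      exact ⟨hi.1, fun j hj => h1.le.trans (hle j hj)⟩
    refine ⟨f + g, ?_⟩
    rw [argminOn_restrict (hφ ▸ argminOn_subset _ _)
      (argminOn_nonempty _ (hS.nonempty C hC)) hsub]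
    refine argminOn_eq_of_add_const (c := c) fun i hi => ?_
    rw [hg i hi, LinearMap.add_apply]
    ring
  refine ⟨hne, ?_, ?_, ?_⟩
  · rintro _ ⟨C, hC, f, rfl⟩ F ⟨-, φ, hF⟩
    have hF : F = argminOn (fun i => φ (p i)) (argminOn (fun i => w C i + f (p i)) C) := hF
    obtain ⟨ε, -, hε⟩ := exists_pos_argminOn_argminOn (fun i => w C i + f (p i))
      (fun i => φ (p i)) C
    refine ⟨C, hC, f + ε • φ, ?_⟩
    rw [hF, hε]
    simp only [LinearMap.add_apply, LinearMap.smul_apply, smul_eq_mul, add_assoc]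
  · rw [← hS.union_eq]
    apply subset_antisymm
    · apply iUnion₂_subset
      rintro _ ⟨C, hC, f, rfl⟩
      exact (convexHull_mono (image_mono (argminOn_subset _ _))).trans
        (subset_biUnion_of_mem (u := fun C => convexHull ℝ (p '' C)) hC)
    · apply iUnion₂_subset
      intro C hC x hx
      obtain ⟨F, hFC, hFx⟩ := exists_face_inCore C hx
      obtain ⟨f, hf⟩ := hFx.exists_mem_convexHull_lowerFace (w F)
      exact mem_biUnion (t := fun C => convexHull ℝ (p '' C))
        ⟨F, hS.face_mem C hC F hFC, f, rfl⟩ hf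
  · intro C hC D hD hCD
    rw [Set.disjoint_left]
    intro x hxC hxD
    have hxC := inCore_of_mem_intrinsicInterior hxC
    have hxD := inCore_of_mem_intrinsicInterior hxD
    obtain ⟨F, hF, hFx, f, rfl⟩ := hcore C hC x hxC
    obtain ⟨G, hG, hGx, g, rfl⟩ := hcore D hD x hxD
    obtain rfl := hS.eq_of_inCore hF hG hFx hGx
    exact hCD (subset_antisymm (argminOn_subset_of_inCore hxD.1 hxC)
      (argminOn_subset_of_inCore hxC.1 hxD))

end Core

/-! ### Affine dependences -/

section Dependences

variable {n d : ℕ} {a : Fin n → EuclideanSpace ℝ (Fin d)}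

theorem eq_zero_of_isAffineDependence {N : Finset (Fin n)}
    (hN : AffineIndependent ℝ (fun i : N => a i)) {c : Fin n → ℝ} (hc : IsAffineDependence a c)
    (hcN : ∀ i, i ∉ N → c i = 0) : c = 0 := by
  have h1 : ∑ i : N, c i = 0 := by
    rw [Finset.sum_coe_sort N c, ← hc.1]
    exact Finset.sum_subset (Finset.subset_univ _) fun i _ hi => hcN i hi
  have h2 : ∑ i : N, c i • a i = 0 := by
    rw [Finset.sum_coe_sort N (fun i => c i • a i), ← hc.2]
    exact Finset.sum_subset (Finset.subset_univ _) fun i _ hi => by simp [hcN i hi]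
  have h3 := (affineIndependent_iff.1 hN) Finset.univ (fun i => c i) h1 h2
  funext i
  by_cases hi : i ∈ N
  · exact h3 ⟨i, hi⟩ (Finset.mem_univ _)
  · exact hcN i hi

theorem exists_isAffineDependence {N : Finset (Fin n)}
    (hN : ¬ AffineIndependent ℝ (fun i : N => a i)) :
    ∃ c : Fin n → ℝ, IsAffineDependence a c ∧ c ≠ 0 ∧ ∀ i, i ∉ N → c i = 0 := by
  rw [affineIndependent_iff] at hN
  push Not at hN
  obtain ⟨s, w, hw, hwa, ⟨j, hj⟩, hjs, hwj⟩ := hN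
  classical
  set c : Fin n → ℝ := fun i => if h : i ∈ N then (if (⟨i, h⟩ : N) ∈ s then w ⟨i, h⟩ else 0) else 0
    with hc
  have hcN : ∀ i, i ∉ N → c i = 0 := fun i hi => by simp [hc, hi]
  have hci : ∀ i : N, c i = if i ∈ s then w i else 0 := fun i => by simp [hc]
  refine ⟨c, ⟨?_, ?_⟩, ?_, hcN⟩
  · rw [← Finset.sum_subset (Finset.subset_univ N) fun i _ hi => hcN i hi,
      ← Finset.sum_coe_sort N c]
    simp only [hci]
    rwa [Finset.sum_ite_mem, Finset.univ_inter]
  · rw [← Finset.sum_subset (Finset.subset_univ N) (f := fun i => c i • a i)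
      fun i _ hi => by simp [hcN i hi], ← Finset.sum_coe_sort N (fun i => c i • a i)]
    simp only [hci, ite_smul, zero_smul]
    rwa [Finset.sum_ite_mem, Finset.univ_inter]
  · intro h
    have h1 := hci ⟨j, hj⟩
    rw [h, if_pos hjs] at h1
    exact hwj h1.symm

/-- A function on an affinely independent set of labels is the restriction of an affine function. -/
theorem exists_affine_extension {N : Finset (Fin n)}
    (hN : AffineIndependent ℝ (fun i : N => a i)) (w : Fin n → ℝ) :
    ∃ (f : EuclideanSpace ℝ (Fin d) →ₗ[ℝ] ℝ) (τ : ℝ), ∀ i ∈ N, w i = f (a i) + τ := by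
  rcases N.eq_empty_or_nonempty with rfl | ⟨j, hj⟩
  · exact ⟨0, 0, by simp⟩
  have hli := (affineIndependent_iff_linearIndependent_vsub ℝ _ (⟨j, hj⟩ : N)).1 hN
  obtain ⟨g, hg⟩ := LinearMap.exists_leftInverse_of_injective _
    (LinearMap.ker_eq_bot.2 hli)
  set f := (Finsupp.linearCombination ℝ
    (fun i : {x : N // x ≠ ⟨j, hj⟩} => w i - w j)) ∘ₗ g with hf
  refine ⟨f, w j - f (a j), fun i hi => ?_⟩
  by_cases hij : i = j
  · subst hij
    ring
  have h1 := LinearMap.congr_fun hg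
    (Finsupp.single (⟨⟨i, hi⟩, by simpa using hij⟩ : {x : N // x ≠ ⟨j, hj⟩}) 1)
  simp only [LinearMap.comp_apply, Finsupp.linearCombination_single, one_smul, vsub_eq_sub,
    LinearMap.id_apply] at h1
  have h2 : f (a i - a j) = w i - w j := by
    rw [hf, LinearMap.comp_apply, h1]
    simp
  rw [map_sub] at h2
  linarith

theorem not_affineIndependent_of_card {N : Finset (Fin n)}
    (hN : Module.finrank ℝ (vectorSpan ℝ (range a)) + 1 < N.card) :
    ¬ AffineIndependent ℝ (fun i : N => a i) := by
  intro h
  have h1 := h.card_le_finrank_succ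
  rw [Fintype.card_coe] at h1
  have h2 : Module.finrank ℝ (vectorSpan ℝ (range fun i : N => a i)) ≤
      Module.finrank ℝ (vectorSpan ℝ (range a)) := by
    apply Submodule.finrank_mono
    apply vectorSpan_mono
    rintro _ ⟨i, rfl⟩
    exact ⟨i, rfl⟩
  omega

/-- In general position, a functional which is constant on many points is constant. -/
theorem InGeneralPosition.eq_const (ha : InGeneralPosition a) {N : Finset (Fin n)}
    (hN : Module.finrank ℝ (vectorSpan ℝ (range a)) + 1 ≤ N.card)
    {f : EuclideanSpace ℝ (Fin d) →ₗ[ℝ] ℝ} {τ : ℝ} (hf : ∀ i ∈ N, f (a i) = τ) (i : Fin n) :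
    f (a i) = τ := by
  obtain ⟨N', hN'N, hcard⟩ := Finset.exists_subset_card_eq hN
  have hind := ha N' hcard.le
  have hne : N'.Nonempty := Finset.card_pos.1 (by omega)
  obtain ⟨j, hj⟩ := hne
  have : Nonempty N' := ⟨⟨j, hj⟩⟩
  have h1 := hind.finrank_vectorSpan_add_one
  rw [Fintype.card_coe, hcard] at h1
  have h2 : vectorSpan ℝ (range fun i : N' => a i) = vectorSpan ℝ (range a) := by
    apply Submodule.eq_of_le_of_finrank_eq
    · apply vectorSpan_mono
      rintro _ ⟨i, rfl⟩
      exact ⟨i, rfl⟩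
    · omega
  have h3 : vectorSpan ℝ (range fun i : N' => a i) ≤ LinearMap.ker f := by
    refine Submodule.span_le.2 ?_
    rintro _ ⟨_, ⟨x, rfl⟩, _, ⟨y, rfl⟩, rfl⟩
    simp [hf x (hN'N x.2), hf y (hN'N y.2)]
  have h4 : a i - a j ∈ vectorSpan ℝ (range a) := vsub_mem_vectorSpan ℝ ⟨i, rfl⟩ ⟨j, rfl⟩
  rw [← h2] at h4
  have h5 := h3 h4
  rw [LinearMap.mem_ker, map_sub, hf j (hN'N hj)] at h5
  linarith

/-! ### Circuits and generic heights -/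

theorem IsCircuit.disjoint {Cp Cm : Finset (Fin n)} (h : IsCircuit a Cp Cm) : Disjoint Cp Cm := by
  obtain ⟨c, -, -, -, hp, hm⟩ := h
  rw [Finset.disjoint_left]
  intro i hi hi'
  exact lt_asymm ((hp i).1 hi) ((hm i).1 hi')

theorem IsCircuit.nonempty {Cp Cm : Finset (Fin n)} (h : IsCircuit a Cp Cm) :
    Cp.Nonempty ∧ Cm.Nonempty := by
  obtain ⟨c, hc, hc0, -, hp, hm⟩ := h
  constructor
  · by_contra! hemp
    have h1 : ∀ i ∈ Finset.univ, c i ≤ 0 := fun i _ => by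
      by_contra! hi
      simpa [hemp] using (hp i).2 hi
    exact hc0 (funext fun i => (Finset.sum_eq_zero_iff_of_nonpos h1).1 hc.1 i (Finset.mem_univ i))
  · by_contra! hemp
    have h1 : ∀ i ∈ Finset.univ, 0 ≤ c i := fun i _ => by
      by_contra! hi
      simpa [hemp] using (hm i).2 hi
    exact hc0 (funext fun i => (Finset.sum_eq_zero_iff_of_nonneg h1).1 hc.1 i (Finset.mem_univ i))

theorem IsCircuit.card_le {Cp Cm : Finset (Fin n)} (h : IsCircuit a Cp Cm) :
    (Cp ∪ Cm).card ≤ Module.finrank ℝ (vectorSpan ℝ (range a)) + 2 := by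
  obtain ⟨c, hc, hc0, hmin, hp, hm⟩ := h
  by_contra! hcard
  obtain ⟨N, hN, hNcard⟩ := Finset.exists_subset_card_eq hcard.le
  obtain ⟨c', hc', hc'0, hc'N⟩ := exists_isAffineDependence (a := a) (N := N)
    (not_affineIndependent_of_card (by omega))
  have hsupp : ∀ i, i ∈ Cp ∪ Cm ↔ i ∈ Function.support c := by
    intro i
    rw [Finset.mem_union, hp, hm, Function.mem_support, or_comm, ne_iff_lt_or_gt]
  have hsub : Function.support c' ⊆ (N : Set (Fin n)) := by
    intro i hi
    by_contra hiN
    exact hi (hc'N i hiN)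
  have heq := hmin c' hc' hc'0 fun i hi => (hsupp i).1 (hN (hsub hi))
  have : Cp ∪ Cm ⊆ N := fun i hi => hsub (heq ▸ (hsupp i).1 hi)
  have := Finset.card_le_card this
  omega

theorem IsCircuit.symm {Cp Cm : Finset (Fin n)} (h : IsCircuit a Cp Cm) : IsCircuit a Cm Cp := by
  obtain ⟨c, hc, hc0, hmin, hp, hm⟩ := h
  refine ⟨-c, ⟨by simpa using hc.1, by simpa using hc.2⟩, by simpa using hc0, ?_, ?_, ?_⟩
  · rwa [Function.support_neg]
  · simpa using hm
  · simpa using hp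

/-- Heights which are affine only on affinely independent sets of labels. -/
def IsGeneric (a : Fin n → EuclideanSpace ℝ (Fin d)) (w : Fin n → ℝ) : Prop :=
  ∀ (N : Finset (Fin n)) (f : EuclideanSpace ℝ (Fin d) →ₗ[ℝ] ℝ) (τ : ℝ),
    (∀ i ∈ N, w i = f (a i) + τ) → AffineIndependent ℝ (fun i : N => a i)

/-- There are generic heights with prescribed signs that vanish on an affinely independent set. -/
theorem exists_isGeneric {J : Finset (Fin n)} (hJ : AffineIndependent ℝ (fun i : J => a i))
    (s : Fin n → ℝ) (hs : ∀ i, s i ≠ 0) :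
    ∃ t : Fin n → ℝ, (∀ i, 0 < t i) ∧ IsGeneric a (fun i => if i ∈ J then 0 else s i * t i) := by
  classical
  have hdep : ∀ N : Finset (Fin n), ∃ c : Fin n → ℝ, ¬ AffineIndependent ℝ (fun i : N => a i) →
      IsAffineDependence a c ∧ c ≠ 0 ∧ ∀ i, i ∉ N → c i = 0 := by
    intro N
    by_cases h : AffineIndependent ℝ (fun i : N => a i)
    · exact ⟨0, fun h' => absurd h h'⟩
    · obtain ⟨c, hc⟩ := exists_isAffineDependence h
      exact ⟨c, fun _ => hc⟩
  choose c hc using hdep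
  -- The heights off `J` will be `s i * t ^ i`. `P N` is their pairing with a dependence supported
  -- in `N`, as a polynomial in `t`. It is nonzero because no nonzero dependence is supported in
  -- `J`, so all but finitely many `t` avoid the roots.
  let P : Finset (Fin n) → Polynomial ℝ := fun N =>
    ∑ i ∈ Jᶜ, Polynomial.monomial (i : ℕ) (c N i * s i)
  have hP : ∀ N : Finset (Fin n), ¬ AffineIndependent ℝ (fun i : N => a i) → P N ≠ 0 := by
    intro N hN hzero
    obtain ⟨h1, h2, -⟩ := hc N hN
    refine h2 (eq_zero_of_isAffineDependence hJ h1 fun i hi => ?_)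
    have h3 := congrArg (fun Q => Polynomial.coeff Q (i : ℕ)) hzero
    simp only [P, Polynomial.finsetSum_coeff, Polynomial.coeff_monomial, Fin.val_inj,
      Polynomial.coeff_zero, Finset.sum_ite_eq', Finset.mem_compl, hi, not_false_eq_true,
      if_true] at h3
    exact (mul_eq_zero.1 h3).resolve_right (hs i)
  have hfin : (⋃ N : Finset (Fin n), {t : ℝ | P N ≠ 0 ∧ (P N).IsRoot t}).Finite := by
    refine finite_iUnion fun N => ?_
    by_cases h : P N = 0
    · simp [h]
    · exact (Polynomial.finite_setOfPred_isRoot h).subset fun t ht => ht.2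
  obtain ⟨t, ht, hroot⟩ := ((Ioi_infinite (0 : ℝ)).sdiff hfin).nonempty
  have ht : 0 < t := ht
  refine ⟨fun i => t ^ (i : ℕ), fun i => pow_pos ht _, fun N f τ hw => ?_⟩
  by_contra hN
  obtain ⟨h1, -, h3⟩ := hc N hN
  refine hroot (mem_iUnion.2 ⟨N, hP N hN, ?_⟩)
  have h4 : ∑ i, c N i * (if i ∈ J then 0 else s i * t ^ (i : ℕ)) = 0 := by
    calc ∑ i, c N i * (if i ∈ J then 0 else s i * t ^ (i : ℕ))
        = ∑ i, c N i * (f (a i) + τ) := by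
          refine Finset.sum_congr rfl fun i _ => ?_
          by_cases hi : i ∈ N
          · rw [← hw i hi]
          · simp [h3 i hi]
      _ = f (∑ i, c N i • a i) + (∑ i, c N i) * τ := by
          simp [mul_add, Finset.sum_add_distrib, Finset.sum_mul]
      _ = 0 := by simp [h1.1, h1.2]
  rw [Polynomial.IsRoot.def, Polynomial.eval_finsetSum, ← h4,
    ← Finset.sum_subset (Finset.subset_univ Jᶜ)]
  · refine Finset.sum_congr rfl fun i hi => ?_
    rw [Polynomial.eval_monomial, if_neg (Finset.mem_compl.1 hi), mul_assoc]
  · intro i _ hi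
    have : i ∈ J := by simpa using hi
    simp [this]

end Dependences

/-! ### Level slices of intervals -/

section Slices

variable {n k : ℕ} {X Y : Finset (Fin n)}

/-- The intervals that correspond to the nonempty faces of the hypersimplex. -/
def IsTile (k : ℕ) (X Y : Finset (Fin n)) : Prop :=
  X ⊆ Y ∧ ((X.card < k ∧ k < Y.card) ∨ (X = Y ∧ X.card = k))

theorem IsTile.card_le (h : IsTile k X Y) : X.card ≤ k ∧ k ≤ Y.card := by
  obtain ⟨-, ⟨h1, h2⟩ | ⟨rfl, h⟩⟩ := h
  · exact ⟨h1.le, h2.le⟩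
  · exact ⟨h.le, h.ge⟩

/-- If `X` or `Y` already has `k` elements, the slice is a single vertex, whose tile is a one-point
interval. -/
theorem exists_isTile (hXY : X ⊆ Y) (hX : X.card ≤ k) (hY : k ≤ Y.card) :
    ∃ X' Y', IsTile k X' Y' ∧ X ⊆ X' ∧ Y' ⊆ Y ∧ levelSlice k X' Y' = levelSlice k X Y := by
  rcases hX.lt_or_eq with hX' | hX'
  · rcases hY.lt_or_eq with hY' | hY'
    · exact ⟨X, Y, ⟨hXY, Or.inl ⟨hX', hY'⟩⟩, subset_rfl, subset_rfl, rfl⟩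
    · refine ⟨Y, Y, ⟨subset_rfl, Or.inr ⟨rfl, hY'.symm⟩⟩, hXY, subset_rfl, ?_⟩
      ext B
      refine ⟨fun h => ⟨hXY.trans h.1, h.2⟩, fun h => ⟨?_, h.2⟩⟩
      rw [Finset.eq_of_subset_of_card_le h.2 (by rw [B.2, hY'])]
  · refine ⟨X, X, ⟨subset_rfl, Or.inr ⟨rfl, hX'⟩⟩, subset_rfl, hXY, ?_⟩
    ext B
    refine ⟨fun h => ⟨h.1, h.2.trans hXY⟩, fun h => ⟨h.1, ?_⟩⟩
    rw [Finset.eq_of_subset_of_card_le h.1 (by rw [B.2, hX'])]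

theorem IsTile.exists_mem_notMem (h : IsTile k X Y) {i : Fin n} (hi : i ∉ X) :
    ∃ B ∈ levelSlice k X Y, i ∉ B.1 := by
  obtain ⟨hXY, ⟨h1, h2⟩ | ⟨rfl, h⟩⟩ := h
  · have hcard := Finset.pred_card_le_card_erase (s := Y) (a := i)
    obtain ⟨B, hXB, hBY, hB⟩ := Finset.exists_subsuperset_card_eq
      (Finset.subset_erase.2 ⟨hXY, hi⟩) h1.le (by omega : k ≤ (Y.erase i).card)
    exact ⟨⟨B, hB⟩, ⟨hXB, hBY.trans (Finset.erase_subset _ _)⟩,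
      fun hiB => Finset.notMem_erase i Y (hBY hiB)⟩
  · exact ⟨⟨X, h⟩, ⟨subset_rfl, subset_rfl⟩, hi⟩

theorem IsTile.exists_mem_mem (h : IsTile k X Y) {i : Fin n} (hi : i ∈ Y) :
    ∃ B ∈ levelSlice k X Y, i ∈ B.1 := by
  obtain ⟨hXY, ⟨h1, h2⟩ | ⟨rfl, h⟩⟩ := h
  · have hcard := Finset.card_insert_le i X
    obtain ⟨B, hXB, hBY, hB⟩ := Finset.exists_subsuperset_card_eq
      (Finset.insert_subset hi hXY) (by omega : (insert i X).card ≤ k) h2.le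
    exact ⟨⟨B, hB⟩, ⟨(Finset.subset_insert _ _).trans hXB, hBY⟩,
      hXB (Finset.mem_insert_self _ _)⟩
  · exact ⟨⟨X, h⟩, ⟨subset_rfl, subset_rfl⟩, hi⟩

theorem IsTile.eq_of_levelSlice_eq {X' Y' : Finset (Fin n)} (h : IsTile k X Y)
    (h' : IsTile k X' Y') (heq : levelSlice k X Y = levelSlice k X' Y') : X = X' ∧ Y = Y' := by
  have key : ∀ {X Y X' Y' : Finset (Fin n)}, IsTile k X Y → IsTile k X' Y' →
      levelSlice k X Y = levelSlice k X' Y' → X ⊆ X' ∧ Y ⊆ Y' := by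
    intro X Y X' Y' h h' heq
    constructor
    · intro i hi
      by_contra hi'
      obtain ⟨B, hB, hiB⟩ := h'.exists_mem_notMem hi'
      rw [← heq] at hB
      exact hiB (hB.1 hi)
    · intro i hi
      obtain ⟨B, hB, hiB⟩ := h.exists_mem_mem hi
      rw [heq] at hB
      exact hB.2 hiB
  exact ⟨(key h h' heq).1.antisymm (key h' h heq.symm).1,
    (key h h' heq).2.antisymm (key h' h heq.symm).2⟩

/-! ### Faces of a slice selected by a functional -/

theorem exists_threshold (M : Finset (Fin n)) (u : Fin n → ℝ) {m : ℕ} (hm : m ≤ M.card) :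
    ∃ τ : ℝ, {i ∈ M | u i < τ}.card ≤ m ∧ m ≤ {i ∈ M | u i ≤ τ}.card := by
  classical
  rcases M.eq_empty_or_nonempty with rfl | hM
  · exact ⟨0, by simp, by simpa using hm⟩
  -- The least `u j` with at least `m` elements at or below it is the threshold. Were there more
  -- than `m` elements strictly below, the largest of them would also qualify.
  set G := {j ∈ M | m ≤ {i ∈ M | u i ≤ u j}.card} with hG
  have hGne : G.Nonempty := by
    obtain ⟨j, hj, hmax⟩ := M.exists_max_image u hM
    refine ⟨j, Finset.mem_filter.2 ⟨hj, ?_⟩⟩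
    rwa [Finset.filter_true_of_mem hmax]
  obtain ⟨j, hj, hmin⟩ := G.exists_min_image u hGne
  refine ⟨u j, ?_, (Finset.mem_filter.1 hj).2⟩
  by_contra! hlt
  obtain ⟨l, hl, hmax⟩ := Finset.exists_max_image {i ∈ M | u i < u j} u
    (Finset.card_pos.1 (by omega))
  obtain ⟨hlM, hlj⟩ := Finset.mem_filter.1 hl
  refine absurd (hmin l (Finset.mem_filter.2 ⟨hlM, hlt.le.trans (Finset.card_le_card ?_)⟩))
    (not_le.2 hlj)
  intro i hi
  exact Finset.mem_filter.2 ⟨(Finset.mem_filter.1 hi).1, hmax i hi⟩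

/-- All sets have `k` elements, so subtracting `τ` from `u` shifts every sum by `k * τ`. Relative to
`X'`, a set then pays `u i - τ ≥ 0` for each added element and `τ - u i > 0` for each omitted one;
the minimizers pay nothing. -/
theorem argminOn_levelSlice_of_threshold {X' Y' : Finset (Fin n)} {u : Fin n → ℝ} {τ : ℝ}
    (hXX' : X ⊆ X') (hXY' : X' ⊆ Y') (hYY' : Y' ⊆ Y) (hX' : X'.card ≤ k) (hY' : k ≤ Y'.card)
    (hlt : ∀ i ∈ X' \ X, u i < τ) (heq : ∀ i ∈ Y' \ X', u i = τ) (hgt : ∀ i ∈ Y \ Y', τ < u i) :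
    argminOn (fun B : KSubset n k => ∑ i ∈ B.1, u i) (levelSlice k X Y) = levelSlice k X' Y' := by
  have hsum : ∀ B : KSubset n k, ∑ i ∈ B.1, u i = (∑ i ∈ X', (u i - τ) + k * τ) +
      (∑ i ∈ B.1 \ X', (u i - τ) + ∑ i ∈ X' \ B.1, (τ - u i)) := by
    intro B
    have h1 := Finset.sum_sdiff_sub_sum_sdiff (s₁ := B.1) (s₂ := X') (f := fun i => u i - τ)
    have h2 : ∑ i ∈ B.1, (u i - τ) = ∑ i ∈ B.1, u i - k * τ := by
      rw [Finset.sum_sub_distrib, Finset.sum_const, B.2, nsmul_eq_mul]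
    have h3 : ∑ i ∈ X' \ B.1, (τ - u i) = - ∑ i ∈ X' \ B.1, (u i - τ) := by
      rw [← Finset.sum_neg_distrib]
      exact Finset.sum_congr rfl fun i _ => by ring
    linarith
  have hge : ∀ i ∈ Y \ X', 0 ≤ u i - τ := by
    intro i hi
    obtain ⟨hiY, hiX⟩ := Finset.mem_sdiff.1 hi
    by_cases h : i ∈ Y'
    · rw [heq i (Finset.mem_sdiff.2 ⟨h, hiX⟩), sub_self]
    · linarith [hgt i (Finset.mem_sdiff.2 ⟨hiY, h⟩)]
  have hpos₁ : ∀ B ∈ levelSlice k X Y, ∀ i ∈ B.1 \ X', 0 ≤ u i - τ := fun B hB i hi =>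
    hge i (Finset.sdiff_subset_sdiff hB.2 subset_rfl hi)
  have hpos₂ : ∀ B ∈ levelSlice k X Y, ∀ i ∈ X' \ B.1, 0 < τ - u i := fun B hB i hi =>
    sub_pos.2 (hlt i (Finset.sdiff_subset_sdiff subset_rfl hB.1 hi))
  have hsub : levelSlice k X' Y' ⊆ levelSlice k X Y :=
    fun B hB => ⟨hXX'.trans hB.1, hB.2.trans hYY'⟩
  have hval : ∀ B ∈ levelSlice k X' Y', ∑ i ∈ B.1, u i = ∑ i ∈ X', (u i - τ) + k * τ := by
    intro B hB
    rw [hsum B, Finset.sdiff_eq_empty_iff_subset.2 hB.1, Finset.sum_empty, add_zero,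
      Finset.sum_eq_zero (s := B.1 \ X'), add_zero]
    intro i hi
    rw [heq i (Finset.sdiff_subset_sdiff hB.2 subset_rfl hi), sub_self]
  ext B
  constructor
  · rintro ⟨hB, hmin⟩
    obtain ⟨B₀, hXB, hBY, hB₀⟩ := Finset.exists_subsuperset_card_eq hXY' hX' hY'
    have h0 : (⟨B₀, hB₀⟩ : KSubset n k) ∈ levelSlice k X' Y' := ⟨hXB, hBY⟩
    have h1 := hmin _ (hsub h0)
    simp only at h1
    rw [hval _ h0, hsum B] at h1
    have h2 := Finset.sum_nonneg (hpos₁ B hB)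
    have h3 := Finset.sum_nonneg fun i hi => (hpos₂ B hB i hi).le
    have h4 := (Finset.sum_eq_zero_iff_of_nonneg (hpos₁ B hB)).1 (by linarith)
    have h5 := (Finset.sum_eq_zero_iff_of_nonneg fun i hi => (hpos₂ B hB i hi).le).1 (by linarith)
    constructor
    · intro i hi
      by_contra hiB
      have hi' := Finset.mem_sdiff.2 ⟨hi, hiB⟩
      exact (hpos₂ B hB i hi').ne' (h5 i hi')
    · intro i hi
      by_contra hiY
      have h6 := h4 i (Finset.mem_sdiff.2 ⟨hi, fun h => hiY (hXY' h)⟩)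
      have h7 := hgt i (Finset.mem_sdiff.2 ⟨hB.2 hi, hiY⟩)
      linarith
  · intro hB
    refine ⟨hsub hB, fun D hD => ?_⟩
    simp only
    rw [hval B hB, hsum D]
    have h2 := Finset.sum_nonneg (hpos₁ D hD)
    have h3 := Finset.sum_nonneg fun i hi => (hpos₂ D hD i hi).le
    linarith

/-- The face of a face of the hypersimplex at which a linear functional is minimal. -/
theorem exists_argminOn_levelSlice (hXY : X ⊆ Y) (hX : X.card ≤ k) (hY : k ≤ Y.card)
    (u : Fin n → ℝ) : ∃ (X' Y' : Finset (Fin n)) (τ : ℝ), IsTile k X' Y' ∧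
      (∀ i ∈ Y' \ X', u i = τ) ∧
      argminOn (fun B : KSubset n k => ∑ i ∈ B.1, u i) (levelSlice k X Y) = levelSlice k X' Y' := by
  classical
  obtain ⟨τ, h1, h2⟩ := exists_threshold (Y \ X) u (m := k - X.card)
    (by rw [Finset.card_sdiff_of_subset hXY]; omega)
  set A := {i ∈ Y \ X | u i < τ} with hA
  set B := {i ∈ Y \ X | u i ≤ τ} with hB
  have hAX : Disjoint X A := Finset.disjoint_sdiff.mono_right (Finset.filter_subset _ _)
  have hBX : Disjoint X B := Finset.disjoint_sdiff.mono_right (Finset.filter_subset _ _)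
  have hAB : A ⊆ B := fun i hi => by
    rw [hA, Finset.mem_filter] at hi
    exact Finset.mem_filter.2 ⟨hi.1, hi.2.le⟩
  have hcA := Finset.card_union_of_disjoint hAX
  have hcB := Finset.card_union_of_disjoint hBX
  have hBY : X ∪ B ⊆ Y := Finset.union_subset hXY
    ((Finset.filter_subset _ _).trans Finset.sdiff_subset)
  have hAB' : X ∪ A ⊆ X ∪ B := Finset.union_subset_union subset_rfl hAB
  have hmid : ∀ i ∈ (X ∪ B) \ (X ∪ A), u i = τ := by
    intro i hi
    simp only [hA, hB, Finset.mem_sdiff, Finset.mem_union, Finset.mem_filter, not_or, not_and,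
      not_lt] at hi
    obtain ⟨h | h, h', h''⟩ := hi
    · exact absurd h h'
    · exact le_antisymm h.2 (h'' h.1)
  have key := argminOn_levelSlice_of_threshold (k := k) (u := u) (τ := τ)
    (Finset.subset_union_left : X ⊆ X ∪ A) hAB' hBY (by omega) (by omega) ?_ hmid ?_
  · obtain ⟨X', Y', ht, hXX', hYY', hsl⟩ := exists_isTile (k := k) hAB' (by omega) (by omega)
    exact ⟨X', Y', τ, ht, fun i hi => hmid i (Finset.sdiff_subset_sdiff hYY' hXX' hi),
      key.trans hsl.symm⟩
  · intro i hi
    simp only [hA, Finset.mem_sdiff, Finset.mem_union, Finset.mem_filter] at hi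
    tauto
  · intro i hi
    simp only [hB, Finset.mem_sdiff, Finset.mem_union, Finset.mem_filter, not_or, not_and,
      not_le] at hi
    tauto

theorem sum_eq_of_mem_levelSlice {u : Fin n → ℝ} {τ : ℝ} (hu : ∀ i ∈ Y \ X, u i = τ)
    {B : KSubset n k} (hB : B ∈ levelSlice k X Y) :
    ∑ i ∈ B.1, u i = k * τ + ∑ i ∈ X, (u i - τ) := by
  have h1 : ∑ i ∈ B.1, (u i - τ) = ∑ i ∈ X, (u i - τ) := by
    symm
    refine Finset.sum_subset hB.1 fun i hi hiX => ?_
    rw [hu i (Finset.mem_sdiff.2 ⟨hB.2 hi, hiX⟩), sub_self]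
  rw [← h1, Finset.sum_sub_distrib, Finset.sum_const, B.2, nsmul_eq_mul]
  ring

/-- The sets from which a maximal simplicial subtile with prescribed elements is built. -/
theorem exists_subtile {r m : ℕ} (hr : 2 ≤ r) {M P N : Finset (Fin n)} (hM : r + 1 ≤ M.card)
    (hP : P ⊆ M) (hN : N ⊆ M) (hPN : Disjoint P N) (hcard : (P ∪ N).card ≤ r + 1)
    (hne : (P ∪ N).card = r + 1 → P.Nonempty ∧ N.Nonempty) (hm : 0 < m) (hmM : m < M.card) :
    ∃ Z J : Finset (Fin n), Disjoint Z J ∧ Z ∪ J ⊆ M ∧ J.card = r ∧ P ⊆ Z ∪ J ∧ Disjoint N Z ∧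
      Z.card < m ∧ m < Z.card + r := by
  classical
  -- One element `e` of `P ∪ N` may not fit into `J`. With room to spare, `e` is left outside `Z ∪
  -- J`, so it must avoid `P`. If `m = M.card - 1`, then `Z ∪ J` is all of `M` and `e` falls into
  -- `Z`, so it must avoid `N`.
  by_cases hcase : m + 2 ≤ M.card
  · obtain ⟨e, heM, heP, he⟩ : ∃ e ∈ M, e ∉ P ∧ ((P ∪ N).erase e).card ≤ r := by
      by_cases hNe : N.Nonempty
      · obtain ⟨e, he⟩ := hNe
        refine ⟨e, hN he, fun h => Finset.disjoint_left.1 hPN h he, ?_⟩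
        rw [Finset.card_erase_of_mem (Finset.mem_union_right _ he)]
        omega
      · have h1 : (P ∪ N).card ≤ r := by
          by_contra! h
          exact hNe (hne (by omega)).2
        have h2 : P.card < M.card :=
          (Finset.card_le_card Finset.subset_union_left).trans_lt (by omega : (P ∪ N).card < M.card)
        obtain ⟨e, he, heP⟩ := Finset.exists_mem_notMem_of_card_lt_card h2
        exact ⟨e, he, heP, (Finset.card_le_card (Finset.erase_subset _ _)).trans h1⟩
    have hcM : (M.erase e).card = M.card - 1 := Finset.card_erase_of_mem heM
    obtain ⟨J, hJ1, hJ2, hJ3⟩ := Finset.exists_subsuperset_card_eq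
      (Finset.erase_subset_erase e (Finset.union_subset hP hN)) he (by omega)
    have hcJ : (M.erase e \ J).card = M.card - 1 - r := by
      rw [Finset.card_sdiff_of_subset hJ2, hcM, hJ3]
    -- Size `m - 1` meets both bounds since `r ≥ 2`. If fewer elements are available, all are taken,
    -- and `m + 2 ≤ M.card` gives the upper bound on `m`.
    obtain ⟨Z, hZ, hZc⟩ := Finset.exists_subset_card_eq
      (s := M.erase e \ J) (n := min (m - 1) (M.card - 1 - r)) (by omega)
    have hZJ : Disjoint Z J := Finset.sdiff_disjoint.mono_left hZ
    have hPJ : P ⊆ J := fun i hi => hJ1 (Finset.mem_erase.2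
      ⟨fun h => heP (h ▸ hi), Finset.mem_union_left _ hi⟩)
    refine ⟨Z, J, hZJ, Finset.union_subset (hZ.trans (Finset.sdiff_subset.trans
      (Finset.erase_subset _ _))) (hJ2.trans (Finset.erase_subset _ _)), hJ3,
      hPJ.trans Finset.subset_union_right, ?_, by omega, by omega⟩
    rw [Finset.disjoint_left]
    intro i hi hiZ
    obtain ⟨hie, hiJ⟩ := Finset.mem_sdiff.1 (hZ hiZ)
    exact hiJ (hJ1 (Finset.mem_erase.2 ⟨(Finset.mem_erase.1 hie).1, Finset.mem_union_right _ hi⟩))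
  · obtain ⟨e, heM, heN, he⟩ : ∃ e ∈ M, e ∉ N ∧ ((P ∪ N).erase e).card ≤ r := by
      by_cases hPe : P.Nonempty
      · obtain ⟨e, he⟩ := hPe
        refine ⟨e, hP he, Finset.disjoint_left.1 hPN he, ?_⟩
        rw [Finset.card_erase_of_mem (Finset.mem_union_left _ he)]
        omega
      · have h1 : (P ∪ N).card ≤ r := by
          by_contra! h
          exact hPe (hne (by omega)).1
        have h2 : N.card < M.card :=
          (Finset.card_le_card Finset.subset_union_right).trans_lt
            (by omega : (P ∪ N).card < M.card)
        obtain ⟨e, he, heN⟩ := Finset.exists_mem_notMem_of_card_lt_card h2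
        exact ⟨e, he, heN, (Finset.card_le_card (Finset.erase_subset _ _)).trans h1⟩
    obtain ⟨J, hJ1, hJ2, hJ3⟩ := Finset.exists_subsuperset_card_eq
      ((Finset.erase_subset e _).trans (Finset.union_subset hP hN)) he (by omega : r ≤ M.card)
    have hcZ : (M \ J).card = M.card - r := by
      rw [Finset.card_sdiff_of_subset hJ2, hJ3]
    refine ⟨M \ J, J, Finset.sdiff_disjoint, (Finset.sdiff_union_of_subset hJ2).le, hJ3, ?_, ?_,
      by omega, by omega⟩
    · rwa [Finset.sdiff_union_of_subset hJ2]
    · rw [Finset.disjoint_left]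
      intro i hi hiZ
      exact (Finset.mem_sdiff.1 hiZ).2 (hJ1 (Finset.mem_erase.2
        ⟨fun h => heN (h ▸ hi), Finset.mem_union_right _ hi⟩))

end Slices

/-! ### Faces of the hypersimplex and their images -/

section Faces

variable {n d k : ℕ} {a : Fin n → EuclideanSpace ℝ (Fin d)} {X Y : Finset (Fin n)}

theorem map_hypersimplexVertex (f : (Fin n → ℝ) →ₗ[ℝ] ℝ) (B : KSubset n k) :
    f (hypersimplexVertex n k B) = ∑ i ∈ B.1, f (Pi.single i 1) := by
  simp [hypersimplexVertex]

theorem proj_hypersimplexVertex (B : KSubset n k) :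
    proj a (hypersimplexVertex n k B) = ∑ i ∈ B.1, a i := by
  simp [hypersimplexVertex, proj, Fintype.linearCombination_apply_single]

theorem hypersimplexVertex_apply (B : KSubset n k) (i : Fin n) :
    hypersimplexVertex n k B i = if i ∈ B.1 then 1 else 0 := by
  simp [hypersimplexVertex, Finset.sum_apply, Pi.single_apply]

theorem exists_isTile_of_isFace (hkn : k ≤ n) {C : Set (KSubset n k)}
    (h : IsFace (hypersimplexVertex n k) C univ) :
    ∃ X Y, IsTile k X Y ∧ C = levelSlice k X Y := by
  obtain ⟨-, f, hf⟩ := h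
  obtain ⟨X, Y, -, ht, -, hXY⟩ := exists_argminOn_levelSlice (n := n) (k := k)
    (Finset.empty_subset Finset.univ) (by simp) (by simpa using hkn) (fun i => f (Pi.single i 1))
  refine ⟨X, Y, ht, ?_⟩
  have huniv : levelSlice k ∅ (Finset.univ : Finset (Fin n)) = univ := by
    ext B; simp [levelSlice]
  rw [← hXY, hf, huniv]
  simp only [map_hypersimplexVertex]
  rfl

theorem isFace_argminOn {C : Set (KSubset n k)} (h : IsFace (hypersimplexVertex n k) C univ)
    (w : Fin n → ℝ) (f : EuclideanSpace ℝ (Fin d) →ₗ[ℝ] ℝ) :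
    IsFace (hypersimplexVertex n k) (argminOn (fun B : KSubset n k =>
      ∑ i ∈ B.1, w i + f (proj a (hypersimplexVertex n k B))) C) univ := by
  obtain ⟨hne, g, hg⟩ := h
  refine ⟨argminOn_nonempty _ hne, ?_⟩
  have hg : C = argminOn (fun B => g (hypersimplexVertex n k B)) univ := hg
  obtain ⟨ε, -, hε⟩ := exists_pos_argminOn_argminOn (fun B => g (hypersimplexVertex n k B))
    (fun B : KSubset n k => ∑ i ∈ B.1, w i + f (proj a (hypersimplexVertex n k B))) univ
  refine ⟨g + ε • (Fintype.linearCombination ℝ w + f ∘ₗ proj a), ?_⟩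
  rw [hg, hε]
  have hw : ∀ B : KSubset n k, Fintype.linearCombination ℝ w (hypersimplexVertex n k B) =
      ∑ i ∈ B.1, w i := fun B => by
    rw [map_hypersimplexVertex]
    simp [Fintype.linearCombination_apply_single]
  simp only [LinearMap.add_apply, LinearMap.smul_apply, smul_eq_mul, LinearMap.comp_apply, hw]
  rfl

theorem argminOn_height_add (w : Fin n → ℝ) (f : EuclideanSpace ℝ (Fin d) →ₗ[ℝ] ℝ)
    (C : Set (KSubset n k)) :
    argminOn (fun B : KSubset n k => ∑ i ∈ B.1, w i + f (proj a (hypersimplexVertex n k B))) C =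
      argminOn (fun B : KSubset n k => ∑ i ∈ B.1, (w i + f (a i))) C := by
  simp only [proj_hypersimplexVertex, map_sum, Finset.sum_add_distrib]

/-- On a tile with affinely independent free elements all heights are affine. -/
theorem exists_height_eq (hind : AffineIndependent ℝ (fun i : (Y \ X : Finset (Fin n)) => a i))
    (w w' : Fin n → ℝ) :
    ∃ (f : EuclideanSpace ℝ (Fin d) →ₗ[ℝ] ℝ) (c : ℝ), ∀ B ∈ levelSlice k X Y,
      ∑ i ∈ B.1, w i = ∑ i ∈ B.1, w' i + f (proj a (hypersimplexVertex n k B)) + c := by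
  obtain ⟨f, τ, hf⟩ := exists_affine_extension hind (fun i => w i - w' i)
  refine ⟨f, k * τ + ∑ i ∈ X, (w i - w' i - f (a i) - τ), fun B hB => ?_⟩
  have h := sum_eq_of_mem_levelSlice (u := fun i => w i - w' i - f (a i)) (τ := τ)
    (fun i hi => by linarith [hf i hi]) hB
  rw [proj_hypersimplexVertex, map_sum]
  simp only [Finset.sum_sub_distrib] at h ⊢
  linarith

/-- Proper faces of the image of a tile come from tiles with affinely independent free elements. -/
theorem InGeneralPosition.exists_isTile_of_isFace (ha : InGeneralPosition a) (ht : IsTile k X Y)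
    {F : Set (KSubset n k)}
    (hF : IsFace (fun B => proj a (hypersimplexVertex n k B)) F (levelSlice k X Y))
    (hne : F ≠ levelSlice k X Y) :
    ∃ X' Y', IsTile k X' Y' ∧ F = levelSlice k X' Y' ∧
      AffineIndependent ℝ (fun i : (Y' \ X' : Finset (Fin n)) => a i) := by
  obtain ⟨-, f, hf⟩ := hF
  have hF : F = argminOn (fun B : KSubset n k => ∑ i ∈ B.1, f (a i)) (levelSlice k X Y) := by
    rw [hf]
    simp only [proj_hypersimplexVertex, map_sum]
    rfl
  obtain ⟨X', Y', τ, ht', hτ, heq⟩ := exists_argminOn_levelSlice ht.1 ht.card_le.1 ht.card_le.2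
    (fun i => f (a i))
  refine ⟨X', Y', ht', hF.trans heq, ?_⟩
  by_contra hdep
  -- Dependent free elements number at least `D + 1`, so `f` is constant on the whole configuration
  -- and the face is not proper.
  have hcard : Module.finrank ℝ (vectorSpan ℝ (range a)) + 1 ≤ (Y' \ X').card := by
    by_contra! h
    exact hdep (ha _ h.le)
  have hconst := ha.eq_const hcard hτ
  apply hne
  rw [hF]
  refine subset_antisymm (argminOn_subset _ _) fun B hB => ⟨hB, fun D hD => ?_⟩
  simp only [hconst, Finset.sum_const, B.2, D.2, le_refl]

/-- Directions of the slice have coordinate sum zero and support in `Y \ X`, so those killed by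
`proj a` are affine dependences on `Y \ X` and vanish. -/
theorem finrank_vectorSpan_levelSlice
    (hind : AffineIndependent ℝ (fun i : (Y \ X : Finset (Fin n)) => a i)) :
    Module.finrank ℝ (vectorSpan ℝ (hypersimplexVertex n k '' levelSlice k X Y)) =
      Module.finrank ℝ (vectorSpan ℝ
        ((fun B => proj a (hypersimplexVertex n k B)) '' levelSlice k X Y)) := by
  set W := vectorSpan ℝ (hypersimplexVertex n k '' levelSlice k X Y) with hW
  have hmap : vectorSpan ℝ ((fun B => proj a (hypersimplexVertex n k B)) '' levelSlice k X Y) =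
      W.map (proj a) := by
    have h := AffineMap.map_vectorSpan (proj a).toAffineMap
      (s := hypersimplexVertex n k '' levelSlice k X Y)
    rw [image_image] at h
    exact h.symm
  have hdep : ∀ v ∈ W, ∑ i, v i = 0 ∧ ∀ i, i ∉ Y \ X → v i = 0 := by
    intro v hv
    let U : Submodule ℝ (Fin n → ℝ) := LinearMap.ker (Fintype.linearCombination ℝ fun _ => (1 : ℝ)) ⊓
      ⨅ i ∈ {i | i ∉ Y \ X}, LinearMap.ker (LinearMap.proj i : (Fin n → ℝ) →ₗ[ℝ] ℝ)
    have hU : W ≤ U := by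
      refine Submodule.span_le.2 ?_
      rintro _ ⟨_, ⟨B, hB, rfl⟩, _, ⟨D, hD, rfl⟩, rfl⟩
      simp only [U, vsub_eq_sub, SetLike.mem_coe, Submodule.mem_inf, LinearMap.mem_ker, map_sub,
        Submodule.mem_iInf, LinearMap.proj_apply, hypersimplexVertex_apply]
      constructor
      · rw [map_hypersimplexVertex, map_hypersimplexVertex]
        simp [Fintype.linearCombination_apply_single, B.2, D.2]
      · intro i hi
        have hi : i ∉ Y \ X := hi
        by_cases hiX : i ∈ X
        · rw [if_pos (hB.1 hiX), if_pos (hD.1 hiX), sub_self]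
        · have hiY : i ∉ Y := fun h => hi (Finset.mem_sdiff.2 ⟨h, hiX⟩)
          rw [if_neg fun h => hiY (hB.2 h), if_neg fun h => hiY (hD.2 h), sub_self]
    have h := hU hv
    simp only [U, Submodule.mem_inf, LinearMap.mem_ker, Submodule.mem_iInf,
      LinearMap.proj_apply, Fintype.linearCombination_apply, smul_eq_mul, mul_one] at h
    exact ⟨h.1, fun i hi => h.2 i hi⟩
  rw [hmap, ← LinearMap.range_domRestrict]
  symm
  apply LinearMap.finrank_range_of_inj
  rw [← LinearMap.ker_eq_bot, LinearMap.ker_eq_bot']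
  rintro ⟨v, hv⟩ hv0
  have hv0 : proj a v = 0 := hv0
  obtain ⟨h1, h2⟩ := hdep v hv
  exact Subtype.ext (eq_zero_of_isAffineDependence hind ⟨h1, hv0⟩ h2)

/-- Refining every cell of a hypersimplicial subdivision by generic heights gives a
hypertriangulation. -/
theorem IsHypersimplicialSubdivision.isHypertriangulation_lowerFaces (ha : InGeneralPosition a)
    (hkn : k ≤ n) {S : Set (Set (KSubset n k))} (hS : IsHypersimplicialSubdivision a k S)
    {w : Set (KSubset n k) → Fin n → ℝ} (hw : ∀ C, IsGeneric a (w C)) :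
    IsHypertriangulation a k (lowerFaces (fun B => proj a (hypersimplexVertex n k B)) S
      (fun C B => ∑ i ∈ B.1, w C i)) := by
  refine ⟨⟨hS.1.lowerFaces _ ?_, ?_⟩, ?_⟩
  · intro C hC F hF hne
    obtain ⟨X, Y, ht, rfl⟩ := exists_isTile_of_isFace hkn (hS.2 C hC)
    obtain ⟨X', Y', -, rfl, hind⟩ := ha.exists_isTile_of_isFace ht hF hne
    exact exists_height_eq hind _ _
  · rintro _ ⟨C, hC, f, rfl⟩
    exact isFace_argminOn (hS.2 C hC) _ _
  · rintro _ ⟨C, hC, f, rfl⟩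
    obtain ⟨X, Y, ht, rfl⟩ := exists_isTile_of_isFace hkn (hS.2 C hC)
    obtain ⟨X', Y', τ, -, hτ, heq⟩ := exists_argminOn_levelSlice ht.1 ht.card_le.1 ht.card_le.2
      (fun i => w (levelSlice k X Y) i + f (a i))
    rw [argminOn_height_add, heq]
    apply finrank_vectorSpan_levelSlice
    -- On the free elements `w + f` equals `τ`, so `w` agrees there with the affine function `-f +
    -- τ`.
    refine hw (levelSlice k X Y) _ (-f) τ fun i hi => ?_
    rw [LinearMap.neg_apply, ← hτ i hi]
    ring

theorem exists_isGeneric_of_empty (a : Fin n → EuclideanSpace ℝ (Fin d)) :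
    ∃ w : Fin n → ℝ, IsGeneric a w := by
  obtain ⟨t, -, ht⟩ := exists_isGeneric (a := a) (J := ∅)
    (affineIndependent_of_subsingleton ℝ _) 1 (by simp)
  exact ⟨_, ht⟩

/-- Generic heights on a tile for which some lower face `[X', Y']` satisfies `Cp ⊆ Y'` and
`Cm ∩ X' = ∅`. -/
theorem InGeneralPosition.exists_isGeneric_subtile (ha : InGeneralPosition a)
    (hD : Module.finrank ℝ (vectorSpan ℝ (range a)) ≠ 0) (ht : IsTile k X Y)
    {Cp Cm : Finset (Fin n)} (hc : IsCircuit a Cp Cm) (hp : Cp ⊆ Y) (hm : Disjoint Cm X) :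
    ∃ w : Fin n → ℝ, IsGeneric a w ∧ ∃ X' Y', IsTile k X' Y' ∧ X ⊆ X' ∧ Y' ⊆ Y ∧ Cp ⊆ Y' ∧
      Disjoint Cm X' ∧ ∃ f : EuclideanSpace ℝ (Fin d) →ₗ[ℝ] ℝ,
        levelSlice k X' Y' = argminOn (fun B : KSubset n k =>
          ∑ i ∈ B.1, w i + f (proj a (hypersimplexVertex n k B))) (levelSlice k X Y) := by
  classical
  by_cases hind : AffineIndependent ℝ (fun i : (Y \ X : Finset (Fin n)) => a i)
  · obtain ⟨w, hw⟩ := exists_isGeneric_of_empty a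
    obtain ⟨f, c, hf⟩ := exists_height_eq (k := k) hind w 0
    -- The tile is already fine: all heights on it are affine, and `-f` cancels them, so the whole
    -- tile is a lower face.
    refine ⟨w, hw, X, Y, ht, subset_rfl, subset_rfl, hp, hm, -f, ?_⟩
    rw [argminOn_eq_of_add_const (v := fun _ => 0) (c := c)]
    · simp [argminOn]
    · intro B hB
      rw [hf B hB]
      simp
  have hcard : Module.finrank ℝ (vectorSpan ℝ (range a)) + 1 < (Y \ X).card := by
    by_contra! h
    exact hind (ha _ h)
  have hlt : X.card < k ∧ k < Y.card := by
    obtain ⟨-, h | ⟨rfl, -⟩⟩ := ht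
    · exact h
    · simp at hcard
  have hcM := Finset.card_sdiff_of_subset ht.1
  have hsub : Cp ∩ (Y \ X) ∪ Cm ∩ (Y \ X) ⊆ Cp ∪ Cm :=
    Finset.union_subset_union Finset.inter_subset_left Finset.inter_subset_left
  have hne := hc.nonempty
  obtain ⟨Z, J, hZJ, hZJM, hJ, hPZJ, hNZ, hZm, hmZ⟩ := exists_subtile
    (r := Module.finrank ℝ (vectorSpan ℝ (range a)) + 1) (m := k - X.card) (by omega) hcard
    (Finset.inter_subset_right : Cp ∩ (Y \ X) ⊆ Y \ X)
    (Finset.inter_subset_right : Cm ∩ (Y \ X) ⊆ Y \ X)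
    (hc.disjoint.mono Finset.inter_subset_left Finset.inter_subset_left)
    ((Finset.card_le_card hsub).trans hc.card_le)
    (by
      intro h
      have heq := Finset.eq_of_subset_of_card_le hsub (by rw [h]; exact hc.card_le)
      have hM : Cp ∪ Cm ⊆ Y \ X := by
        rw [← heq]
        exact Finset.union_subset Finset.inter_subset_right Finset.inter_subset_right
      obtain ⟨⟨i, hi⟩, ⟨j, hj⟩⟩ := hne
      exact ⟨⟨i, Finset.mem_inter.2 ⟨hi, hM (Finset.mem_union_left _ hi)⟩⟩,
        ⟨j, Finset.mem_inter.2 ⟨hj, hM (Finset.mem_union_right _ hj)⟩⟩⟩)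
    (by omega) (by omega)
  -- The weights are negative on `Z`, zero on `J` and positive elsewhere, so the zero functional
  -- with threshold `0` selects `[X ∪ Z, X ∪ Z ∪ J]`. Genericity is compatible with the zeros
  -- because `J` is independent.
  obtain ⟨t, ht0, hgen⟩ := exists_isGeneric (a := a) (J := J) (ha J hJ.le)
    (fun i => if i ∈ Z then -1 else 1) (fun i => by split_ifs <;> norm_num)
  have hXZJ : Disjoint X (Z ∪ J) := Finset.disjoint_sdiff.mono_right hZJM
  have hcZ := Finset.card_union_of_disjoint
    (hXZJ.mono_right (Finset.subset_union_left : Z ⊆ Z ∪ J))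
  have hcZJ := Finset.card_union_of_disjoint hXZJ
  have hcZJ' := Finset.card_union_of_disjoint hZJ
  have hXY' : X ∪ Z ⊆ X ∪ (Z ∪ J) := Finset.union_subset_union subset_rfl Finset.subset_union_left
  have hY' : X ∪ (Z ∪ J) ⊆ Y := Finset.union_subset ht.1 (hZJM.trans Finset.sdiff_subset)
  refine ⟨_, hgen, X ∪ Z, X ∪ (Z ∪ J), ⟨hXY', Or.inl ⟨by omega, by omega⟩⟩,
    Finset.subset_union_left, hY', ?_, ?_, 0, ?_⟩
  · intro i hi
    by_cases hiX : i ∈ X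
    · exact Finset.mem_union_left _ hiX
    · exact Finset.mem_union_right _ (hPZJ (Finset.mem_inter.2
        ⟨hi, Finset.mem_sdiff.2 ⟨hp hi, hiX⟩⟩))
  · rw [Finset.disjoint_union_right]
    refine ⟨hm, Finset.disjoint_left.2 fun i hi hiZ => ?_⟩
    exact Finset.disjoint_left.1 hNZ
      (Finset.mem_inter.2 ⟨hi, hZJM (Finset.mem_union_left _ hiZ)⟩) hiZ
  · simp only [LinearMap.zero_apply, add_zero]
    symm
    apply argminOn_levelSlice_of_threshold (τ := 0) Finset.subset_union_left hXY' hY'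
      (by omega) (by omega)
    · intro i hi
      have hiZ : i ∈ Z := by
        simp only [Finset.mem_sdiff, Finset.mem_union] at hi
        tauto
      rw [if_neg (Finset.disjoint_left.1 hZJ hiZ), if_pos hiZ]
      linarith [ht0 i]
    · intro i hi
      have hiJ : i ∈ J := by
        simp only [Finset.mem_sdiff, Finset.mem_union] at hi
        tauto
      rw [if_pos hiJ]
    · intro i hi
      simp only [Finset.mem_sdiff, Finset.mem_union, not_or] at hi
      rw [if_neg hi.2.2.2, if_neg hi.2.2.1, one_mul]
      exact ht0 i

/-- If all points of the configuration coincide, a subdivision has just one cell. -/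
theorem eq_of_finrank_eq_zero (hD : Module.finrank ℝ (vectorSpan ℝ (range a)) = 0)
    {S : Set (Set (KSubset n k))} (hS : IsHypersimplicialSubdivision a k S)
    {C C' : Set (KSubset n k)} (hC : C ∈ S) (hC' : C' ∈ S) : C = C' := by
  have hconst : ∀ i j, a i = a j := fun i j => by
    have h : a i - a j ∈ vectorSpan ℝ (range a) := vsub_mem_vectorSpan ℝ ⟨i, rfl⟩ ⟨j, rfl⟩
    rw [Submodule.finrank_eq_zero.1 hD, Submodule.mem_bot] at h
    exact sub_eq_zero.1 h
  have hp : ∀ B D : KSubset n k,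
      proj a (hypersimplexVertex n k B) = proj a (hypersimplexVertex n k D) := fun B D => by
    rw [proj_hypersimplexVertex, proj_hypersimplexVertex]
    rcases B.1.eq_empty_or_nonempty with h | ⟨j, hj⟩
    · have h' : D.1 = ∅ := Finset.card_eq_zero.1 (by rw [D.2, ← B.2, h, Finset.card_empty])
      rw [h, h']
    · rw [Finset.sum_congr rfl fun i _ => hconst i j, Finset.sum_const,
        Finset.sum_congr (s₁ := D.1) rfl fun i _ => hconst i j, Finset.sum_const, B.2, D.2]
  obtain ⟨B, hB⟩ := hS.1.nonempty C hC
  have himg : ∀ C ∈ S, (fun B => proj a (hypersimplexVertex n k B)) '' C =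
      {proj a (hypersimplexVertex n k B)} := by
    intro C hC
    obtain ⟨D, hD⟩ := hS.1.nonempty C hC
    refine subset_antisymm ?_ ?_
    · rintro _ ⟨G, -, rfl⟩
      exact hp G B
    · rintro _ rfl
      exact ⟨D, hD, hp D B⟩
  by_contra hne
  have h := hS.1.disjoint_relint C hC C' hC' hne
  rw [himg C hC, himg C' hC', convexHull_singleton, intrinsicInterior_singleton] at h
  simp at h

end Faces
end Hypersimplicial

open Hypersimplicial

/-! ### Transfer of a non-separating circuit to the refinement -/

theorem mainTheorem8 {n d : ℕ} (a : Fin n → EuclideanSpace ℝ (Fin d))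
    (ha : Hypersimplicial.InGeneralPosition a) (k : ℕ) (hk : 1 ≤ k) (hkn : k ≤ n - 1)
    (hfine : ∀ T : Set (Set (Hypersimplicial.KSubset n k)),
      Hypersimplicial.IsHypertriangulation a k T →
        ¬ Hypersimplicial.ContainsNonSeparatedTiles a T) :
    ∀ S : Set (Set (Hypersimplicial.KSubset n k)),
      Hypersimplicial.IsHypersimplicialSubdivision a k S →
        ¬ Hypersimplicial.ContainsNonSeparatedTiles a S := by
  rintro S hS ⟨X₁, Y₁, X₂, Y₂, ⟨hXY₁, ht₁, hS₁⟩, ⟨hXY₂, ht₂, hS₂⟩, hsep⟩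
  obtain ⟨Cp, Cm, hc, hp, hm, hnot⟩ := not_not.1 hsep
  have hT₁ : IsTile k X₁ Y₁ := ⟨hXY₁, ht₁⟩
  have hT₂ : IsTile k X₂ Y₂ := ⟨hXY₂, ht₂⟩
  -- If the tiles coincide, both parts of the circuit lie in `Y₁ \ X₁`, which the last condition on
  -- the circuit forbids.
  have hne : levelSlice k X₁ Y₁ ≠ levelSlice k X₂ Y₂ := by
    intro heq
    obtain ⟨rfl, rfl⟩ := hT₁.eq_of_levelSlice_eq hT₂ heq
    apply hnot
    rw [Finset.inter_self, Finset.union_self]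
    exact Finset.union_subset hp hm
  by_cases hD : Module.finrank ℝ (vectorSpan ℝ (Set.range a)) = 0
  · exact hne (eq_of_finrank_eq_zero hD hS hS₁ hS₂)
  have hm₁ : Disjoint Cm X₁ := Finset.sdiff_disjoint.mono_left hm
  have hp₂ : Disjoint Cp X₂ := Finset.sdiff_disjoint.mono_left hp
  obtain ⟨w₁, hw₁, X₁', Y₁', hT₁', hX₁, hY₁, hp₁', hm₁', f₁, hf₁⟩ :=
    ha.exists_isGeneric_subtile hD hT₁ hc (hp.trans Finset.sdiff_subset) hm₁
  obtain ⟨w₂, hw₂, X₂', Y₂', hT₂', hX₂, hY₂, hm₂', hp₂', f₂, hf₂⟩ :=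
    -- The opposite circuit is used, since here `Cm` must stay below the upper set and `Cp` must
    -- avoid the lower one.
    ha.exists_isGeneric_subtile hD hT₂ hc.symm (hm.trans Finset.sdiff_subset) hp₂
  classical
  let w : Set (KSubset n k) → Fin n → ℝ := fun C => if C = levelSlice k X₁ Y₁ then w₁ else w₂
  have hw : ∀ C, IsGeneric a (w C) := fun C => by
    simp only [w]
    split_ifs
    exacts [hw₁, hw₂]
  refine hfine _ (hS.isHypertriangulation_lowerFaces ha (by omega) hw)
    ⟨X₁', Y₁', X₂', Y₂', ⟨hT₁'.1, hT₁'.2, _, hS₁, f₁, ?_⟩, ⟨hT₂'.1, hT₂'.2, _, hS₂, f₂, ?_⟩, ?_⟩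
  · simpa only [w, if_true] using hf₁
  · simpa only [w, if_neg hne.symm] using hf₂
  · refine not_not.2 ⟨Cp, Cm, hc, ?_, ?_, fun h => hnot (h.trans ?_)⟩
    · exact fun i hi => Finset.mem_sdiff.2 ⟨hp₁' hi, Finset.disjoint_left.1 hp₂' hi⟩
    · exact fun i hi => Finset.mem_sdiff.2 ⟨hm₂' hi, Finset.disjoint_left.1 hm₁' hi⟩
    · exact Finset.sdiff_subset_sdiff (Finset.inter_subset_inter hY₁ hY₂)
        (Finset.union_subset_union hX₁ hX₂)
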